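/- Consider the linear system $\mathbf x_{t+1}=A\mathbf x_t+\mathbf b u_t+\mathbf n_t$ in $\mathbb R^d$ with scalar controls $u_t$, where the disturbances $\mathbf n_t$ are i.i.d. with law $F$, mean zero and finite second moments. Let $Q$ be symmetric positive semidefinite and $\gamma\in(0,1)$; assume that $(A,\mathbf b)$ is controllable and that $(A,C)$ is observable, where $C=\sqrt\Lambda M$ for a decomposition $Q=M^T\Lambda M$ with $M$ orthogonal and $\Lambda$ diagonal. For $r>0$ and an initial state $\mathbf x_0=\mathbf x$ let $$J_r^*(\mathbf x)=\inf_{\pi}\ \mathbb E^\pi_{\mathbf x}\sum_{t=0}^\infty\gamma^t\left(\mathbf x_t^TQ\mathbf x_t+r\,u_t^2\right)$$ be the optimal discounted cost, the infimum being over all nonanticipatory (possibly randomized) control policies $\pi$. Then, for every $\mathbf x\in\mathbb R^d$, $J_r^*(\mathbf x)$ is finite for all $r>0$, and the function $r\mapsto J^*_r(\mathbf x)$ is concave, nondecreasing and twice continuously differentiable on $(0,\infty)$, with $$\frac{dJ^*_r(\mathbf x)}{dr}\ge 0\quad\text{and}\quad \frac{d^2J^*_r(\mathbf x)}{dr^2}\le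 0\qquad\text{for all } r>0.$$ Moreover, for every $r>0$, $\frac{dJ^*_r(\mathbf x)}{dr}>0$ if and only if the policy $u_t\equiv0$ that exerts no control is not optimal from $\mathbf x$ (that is, does not attain $J^*_r(\mathbf x)$). In particular, $\frac{dJ^*_r(\mathbf x)}{dr}>0$ for all $\mathbf x\in\mathbb R^d$ and all $r>0$ whenever $d\ge1$, $A$ is invertible and the covariance matrix $\mathbb E\,\mathbf n_t\mathbf n_t^T$ is positive definite. -/

import Mathlib

open MeasureTheory ProbabilityTheory Set
open scoped Matrix ENNReal

noncomputable section

namespace LQR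

/-- `(A, b)` is controllable: the vectors `b, A b, …, A^(d-1) b` span `ℝ^d`. -/
def Controllable {d : ℕ} (A : Matrix (Fin d) (Fin d) ℝ) (b : Fin d → ℝ) : Prop :=
  Submodule.span ℝ (Set.range fun k : Fin d => (A ^ (k : ℕ)) *ᵥ b) = ⊤

/-- `(A, C)` is observable: the observations `C y, C A y, …, C A^(d-1) y` all vanish only for
`y = 0`. -/
def Observable {d : ℕ} (A C : Matrix (Fin d) (Fin d) ℝ) : Prop :=
  ∀ y : Fin d → ℝ, (∀ k : Fin d, (C * A ^ (k : ℕ)) *ᵥ y = 0) → y = 0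

/-- `(A, C)` is observable for a square root `C = √Λ M` of `Q = Mᵀ Λ M`, where `M` is orthogonal
and `Λ` is diagonal with nonnegative entries. -/
def ObservableCost {d : ℕ} (A Q : Matrix (Fin d) (Fin d) ℝ) : Prop :=
  ∃ M ∈ Matrix.orthogonalGroup (Fin d) ℝ, ∃ lam : Fin d → ℝ, (∀ i, 0 ≤ lam i) ∧
    Q = Mᵀ * Matrix.diagonal lam * M ∧
    Observable A (Matrix.diagonal (fun i => √(lam i)) * M)

/-- A nonanticipatory, possibly randomized control policy: for every time `t`, a probability
kernel giving the law of the control `u_t` in terms of the past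
`(x_s, u_s)`, `s < t`, and of the current state `x_t`. -/
structure Policy (d : ℕ) where
  /-- The law of the control at time `t`, given the information available at time `t`. -/
  law : (t : ℕ) → Kernel ((Finset.Iio t → (Fin d → ℝ) × ℝ) × (Fin d → ℝ)) ℝ
  /-- These laws are probability measures. -/
  markov : ∀ t, IsMarkovKernel (law t)

instance {d : ℕ} (π : Policy d) (t : ℕ) : IsMarkovKernel (π.law t) := π.markov t

/-- The policy that never exerts any control: `u_t = 0` for all `t`. -/
def zeroPolicy (d : ℕ) : Policy d where
  law _ := Kernel.const _ (Measure.dirac 0)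
  markov _ := inferInstance

/-- The history `(x_s, u_s)`, `s ≤ t`, read as the history `(x_s, u_s)`, `s < t + 1`. -/
def reindex {d : ℕ} (t : ℕ) (h : Finset.Iic t → (Fin d → ℝ) × ℝ) :
    Finset.Iio (t + 1) → (Fin d → ℝ) × ℝ :=
  fun i => h ⟨i.1, Finset.mem_Iic.2 (Nat.lt_succ_iff.1 (Finset.mem_Iio.1 i.2))⟩

theorem measurable_reindex {d : ℕ} (t : ℕ) : Measurable (reindex (d := d) t) :=
  measurable_pi_lambda _ fun _ => measurable_pi_apply _

/-- The state dynamics `x_{t+1} = A x_t + b u_t + n_t`, as a function of the history up to time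
`t` and of the disturbance `n_t`. -/
def nextState {d : ℕ} (A : Matrix (Fin d) (Fin d) ℝ) (b : Fin d → ℝ) (t : ℕ)
    (p : (Finset.Iic t → (Fin d → ℝ) × ℝ) × (Fin d → ℝ)) : Fin d → ℝ :=
  A *ᵥ (p.1 ⟨t, Finset.mem_Iic.2 le_rfl⟩).1 + (p.1 ⟨t, Finset.mem_Iic.2 le_rfl⟩).2 • b + p.2

theorem measurable_nextState {d : ℕ} (A : Matrix (Fin d) (Fin d) ℝ) (b : Fin d → ℝ) (t : ℕ) :
    Measurable (nextState A b t) := by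
  unfold nextState
  have h : Measurable fun v : Fin d → ℝ => A *ᵥ v :=
    (Continuous.matrix_mulVec continuous_const continuous_id).measurable
  exact ((h.comp (by fun_prop)).add (by fun_prop)).add (by fun_prop)

/-- The conditional law of `x_{t+1}` given `(x_s, u_s)`, `s ≤ t`: the disturbance `n_t` is drawn
from `F`, independently of the history. -/
def stateKernel {d : ℕ} (A : Matrix (Fin d) (Fin d) ℝ) (b : Fin d → ℝ)
    (F : Measure (Fin d → ℝ)) (t : ℕ) :
    Kernel (Finset.Iic t → (Fin d → ℝ) × ℝ) (Fin d → ℝ) :=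
  (Kernel.id ×ₖ Kernel.const _ F).map (nextState A b t)

instance {d : ℕ} (A : Matrix (Fin d) (Fin d) ℝ) (b : Fin d → ℝ)
    (F : Measure (Fin d → ℝ)) [IsProbabilityMeasure F] (t : ℕ) :
    IsMarkovKernel (stateKernel A b F t) :=
  Kernel.IsMarkovKernel.map _ (measurable_nextState A b t)

/-- The conditional law of `u_{t+1}` given `(x_s, u_s)`, `s ≤ t`, and `x_{t+1}`, under `π`. -/
def controlKernel {d : ℕ} (π : Policy d) (t : ℕ) :
    Kernel ((Finset.Iic t → (Fin d → ℝ) × ℝ) × (Fin d → ℝ)) ℝ :=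
  (π.law (t + 1)).comap (Prod.map (reindex t) id) ((measurable_reindex t).prodMap measurable_id)

instance {d : ℕ} (π : Policy d) (t : ℕ) : IsMarkovKernel (controlKernel π t) :=
  Kernel.IsMarkovKernel.comap _ _

/-- The conditional law of `(x_{t+1}, u_{t+1})` given `(x_s, u_s)`, `s ≤ t`, under `π`. -/
def transition {d : ℕ} (A : Matrix (Fin d) (Fin d) ℝ) (b : Fin d → ℝ)
    (F : Measure (Fin d → ℝ)) (π : Policy d) (t : ℕ) :
    Kernel (Finset.Iic t → (Fin d → ℝ) × ℝ) ((Fin d → ℝ) × ℝ) :=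
  stateKernel A b F t ⊗ₖ controlKernel π t

instance {d : ℕ} (A : Matrix (Fin d) (Fin d) ℝ) (b : Fin d → ℝ)
    (F : Measure (Fin d → ℝ)) [IsProbabilityMeasure F] (π : Policy d) (t : ℕ) :
    IsMarkovKernel (transition A b F π t) := by
  unfold transition; infer_instance

/-- The law of `(x_0, u_0)` under `π`, when the initial state is `x`. -/
def initial {d : ℕ} (π : Policy d) (x : Fin d → ℝ) : Measure ((Fin d → ℝ) × ℝ) :=
  (π.law 0 (fun _ => 0, x)).map (fun u => (x, u))

instance {d : ℕ} (π : Policy d) (x : Fin d → ℝ) : IsProbabilityMeasure (initial π x) :=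
  Measure.isProbabilityMeasure_map (by fun_prop)

/-- The law on the space of sample paths `(x_t, u_t)_{t ∈ ℕ}` induced by the policy `π` from the
initial state `x` (Ionescu-Tulcea). -/
def pathMeasure {d : ℕ} (A : Matrix (Fin d) (Fin d) ℝ) (b : Fin d → ℝ)
    (F : Measure (Fin d → ℝ)) [IsProbabilityMeasure F] (π : Policy d) (x : Fin d → ℝ) :
    Measure (ℕ → (Fin d → ℝ) × ℝ) :=
  Kernel.trajMeasure (X := fun _ => (Fin d → ℝ) × ℝ) (initial π x) (transition A b F π)

/-- The expected discounted cost `E ∑ γ^t (x_tᵀ Q x_t + r u_t²)` of the policy `π` from the initial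
state `x`, with values in `[0, ∞]`. -/
def cost {d : ℕ} (A : Matrix (Fin d) (Fin d) ℝ) (b : Fin d → ℝ) (F : Measure (Fin d → ℝ))
    [IsProbabilityMeasure F] (Q : Matrix (Fin d) (Fin d) ℝ) (γ r : ℝ) (π : Policy d)
    (x : Fin d → ℝ) : ℝ≥0∞ :=
  ∫⁻ ω, ∑' t : ℕ, ENNReal.ofReal (γ ^ t * ((ω t).1 ⬝ᵥ (Q *ᵥ (ω t).1) + r * (ω t).2 ^ 2))
    ∂(pathMeasure A b F π x)

/-- The optimal discounted cost `J*_r(x)`, the infimum of the cost over all nonanticipatory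
policies, with values in `[0, ∞]`. -/
def optCost {d : ℕ} (A : Matrix (Fin d) (Fin d) ℝ) (b : Fin d → ℝ) (F : Measure (Fin d → ℝ))
    [IsProbabilityMeasure F] (Q : Matrix (Fin d) (Fin d) ℝ) (γ r : ℝ) (x : Fin d → ℝ) : ℝ≥0∞ :=
  ⨅ π : Policy d, cost A b F Q γ r π x

/-- The optimal discounted cost `J*_r(x)` as a real number. -/
def J {d : ℕ} (A : Matrix (Fin d) (Fin d) ℝ) (b : Fin d → ℝ) (F : Measure (Fin d → ℝ))
    [IsProbabilityMeasure F] (Q : Matrix (Fin d) (Fin d) ℝ) (γ r : ℝ) (x : Fin d → ℝ) : ℝ :=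
  (optCost A b F Q γ r x).toReal

end LQR

end

/-! The optimal cost has the form `xᵀ P x + γ / (1 - γ) * E nᵀ P n`, where `P = P_r` is the limit of
value iteration from `0` (`optCost_eq`). The iterates increase, and controllability bounds them
because every state can be steered to `0` in `d` steps (`bddAbove_riccatiIter`). Finite-horizon
values bound every policy from below (`riccatiIter_le_cost`); the linear feedback given by the fixed
point attains the limit (`optCost_le_riccatiLimit`).

For a fixed policy the cost is affine and nondecreasing in `r`, so its infimum over policies is
concave and nondecreasing. With zero noise this says that `r ↦ xᵀ P_r x` is concave, hence
continuous on `(0, ∞)`.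

Smoothness comes from an exact difference identity. If `K_r` is the optimal gain and `M_r` the
closed loop, then `(P_s - P_r) - γ M_rᵀ (P_s - P_r) M_s = (s - r) K_r K_sᵀ` (`riccati_sub_riccati`).
Observability makes `√γ M_r` stable (`closedLoop_stable`), so the Stein operator `X ↦ X - γ M_rᵀ X
M_r` is invertible. Dividing by `s - r` gives the derivative of `P` as the solution of a Stein
equation whose data depend smoothly on `P`, and regularity bootstraps (`contDiffOn_riccatiLimit`).

If the derivative of `J` vanishes at `r`, concavity makes `J_r` an upper bound for `J_s` for all `s
> r`. For each fixed horizon the optimal value tends to that of zero control as `s → ∞`, so zero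
control costs at most `J_r`. Conversely, the cost of zero control does not involve `r`; if it is
optimal at `r`, then `J` has a maximum there.

In the nondegenerate case a zero derivative forces the derivative of `P` to vanish through the noise
term. Then the gain is zero, invertibility of `A` gives `bᵀ P b = 0`, and observability gives `b =
0`, against controllability. -/

noncomputable section

namespace LQR

open Filter Topology

/-! ### Bilinear forms of matrices. -/

variable {d : ℕ}

/-- The bilinear form of the matrix `P`. -/
def bform (P : Matrix (Fin d) (Fin d) ℝ) (x y : Fin d → ℝ) : ℝ := x ⬝ᵥ (P *ᵥ y)

theorem bform_add_left (P : Matrix (Fin d) (Fin d) ℝ) (x y z : Fin d → ℝ) :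
    bform P (x + y) z = bform P x z + bform P y z := by
  simp [bform, add_dotProduct]

theorem bform_add_right (P : Matrix (Fin d) (Fin d) ℝ) (x y z : Fin d → ℝ) :
    bform P x (y + z) = bform P x y + bform P x z := by
  simp [bform, Matrix.mulVec_add, dotProduct_add]

theorem bform_smul_left (P : Matrix (Fin d) (Fin d) ℝ) (c : ℝ) (x y : Fin d → ℝ) :
    bform P (c • x) y = c * bform P x y := by
  simp [bform]

theorem bform_smul_right (P : Matrix (Fin d) (Fin d) ℝ) (c : ℝ) (x y : Fin d → ℝ) :
    bform P x (c • y) = c * bform P x y := by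
  simp [bform, Matrix.mulVec_smul]

@[simp] theorem bform_zero_left (P : Matrix (Fin d) (Fin d) ℝ) (y : Fin d → ℝ) :
    bform P 0 y = 0 := by simp [bform]

@[simp] theorem bform_zero_right (P : Matrix (Fin d) (Fin d) ℝ) (y : Fin d → ℝ) :
    bform P y 0 = 0 := by simp [bform]

@[simp] theorem bform_zero (x y : Fin d → ℝ) :
    bform (0 : Matrix (Fin d) (Fin d) ℝ) x y = 0 := by simp [bform]

theorem bform_add (P P' : Matrix (Fin d) (Fin d) ℝ) (x y : Fin d → ℝ) :
    bform (P + P') x y = bform P x y + bform P' x y := by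
  simp [bform, Matrix.add_mulVec, dotProduct_add]

theorem bform_sub (P P' : Matrix (Fin d) (Fin d) ℝ) (x y : Fin d → ℝ) :
    bform (P - P') x y = bform P x y - bform P' x y := by
  simp [bform, Matrix.sub_mulVec, dotProduct_sub]

theorem bform_smul (c : ℝ) (P : Matrix (Fin d) (Fin d) ℝ) (x y : Fin d → ℝ) :
    bform (c • P) x y = c * bform P x y := by
  simp [bform, Matrix.smul_mulVec]

theorem bform_vecMulVec (v w x y : Fin d → ℝ) :
    bform (Matrix.vecMulVec v w) x y = (v ⬝ᵥ x) * (w ⬝ᵥ y) := by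
  simp [bform, Matrix.vecMulVec_mulVec, dotProduct_comm v x]
  ring

theorem bform_conj (L P R : Matrix (Fin d) (Fin d) ℝ) (x y : Fin d → ℝ) :
    bform (Lᵀ * P * R) x y = bform P (L *ᵥ x) (R *ᵥ y) := by
  simp only [bform, ← Matrix.mulVec_mulVec, Matrix.dotProduct_mulVec _ Lᵀ, Matrix.vecMul_transpose]

theorem bform_symm {P : Matrix (Fin d) (Fin d) ℝ} (hP : P.IsSymm) (x y : Fin d → ℝ) :
    bform P x y = bform P y x := by
  rw [bform, bform, Matrix.dotProduct_mulVec, dotProduct_comm, ← Matrix.mulVec_transpose, hP.eq]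

theorem bform_single (P : Matrix (Fin d) (Fin d) ℝ) (i j : Fin d) :
    bform P (Pi.single i 1) (Pi.single j 1) = P i j := by
  simp [bform]

theorem ext_bform {P P' : Matrix (Fin d) (Fin d) ℝ} (h : ∀ x y, bform P x y = bform P' x y) :
    P = P' := by
  ext i j
  rw [← bform_single P, h, bform_single]

theorem bform_polarization {P : Matrix (Fin d) (Fin d) ℝ} (hP : P.IsSymm) (x y : Fin d → ℝ) :
    bform P x y = (bform P (x + y) (x + y) - bform P x x - bform P y y) / 2 := by
  rw [bform_add_left, bform_add_right, bform_add_right, bform_symm hP y x]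
  ring

theorem continuous_bform (x y : Fin d → ℝ) :
    Continuous fun P : Matrix (Fin d) (Fin d) ℝ => bform P x y := by
  unfold bform
  exact Continuous.dotProduct continuous_const
    (Continuous.matrix_mulVec continuous_id continuous_const)

theorem continuous_bform_self (P : Matrix (Fin d) (Fin d) ℝ) :
    Continuous fun x : Fin d → ℝ => bform P x x := by
  unfold bform
  exact Continuous.dotProduct continuous_id
    (Continuous.matrix_mulVec continuous_const continuous_id)

/-! ### The Riccati operator and its algebra. -/

/-- The closed-loop matrix of the linear feedback `u = K ⬝ᵥ x`. -/
def closedLoop (A : Matrix (Fin d) (Fin d) ℝ) (b K : Fin d → ℝ) : Matrix (Fin d) (Fin d) ℝ :=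
  A + Matrix.vecMulVec b K

theorem closedLoop_mulVec (A : Matrix (Fin d) (Fin d) ℝ) (b K x : Fin d → ℝ) :
    closedLoop A b K *ᵥ x = A *ᵥ x + (K ⬝ᵥ x) • b := by
  simp [closedLoop, Matrix.add_mulVec, Matrix.vecMulVec_mulVec]

/-- The value iteration step for the linear feedback `u = K ⬝ᵥ x`. -/
def feedbackStep (A : Matrix (Fin d) (Fin d) ℝ) (b : Fin d → ℝ) (Q : Matrix (Fin d) (Fin d) ℝ)
    (γ r : ℝ) (K : Fin d → ℝ) (P : Matrix (Fin d) (Fin d) ℝ) : Matrix (Fin d) (Fin d) ℝ :=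
  Q + γ • ((closedLoop A b K)ᵀ * P * closedLoop A b K) + r • Matrix.vecMulVec K K

/-- The optimal feedback gain for the terminal cost `xᵀ P x`. -/
def gain (A : Matrix (Fin d) (Fin d) ℝ) (b : Fin d → ℝ) (γ r : ℝ)
    (P : Matrix (Fin d) (Fin d) ℝ) : Fin d → ℝ :=
  -((γ / (r + γ * bform P b b)) • (b ᵥ* (P * A)))

/-- The Riccati operator. -/
def riccatiStep (A : Matrix (Fin d) (Fin d) ℝ) (b : Fin d → ℝ) (Q : Matrix (Fin d) (Fin d) ℝ)
    (γ r : ℝ) (P : Matrix (Fin d) (Fin d) ℝ) : Matrix (Fin d) (Fin d) ℝ :=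
  feedbackStep A b Q γ r (gain A b γ r P) P

section Step

variable {A : Matrix (Fin d) (Fin d) ℝ} {b : Fin d → ℝ} {Q : Matrix (Fin d) (Fin d) ℝ}
  {γ r : ℝ} {P : Matrix (Fin d) (Fin d) ℝ}

theorem bform_feedbackStep (K : Fin d → ℝ) (x y : Fin d → ℝ) :
    bform (feedbackStep A b Q γ r K P) x y = bform Q x y +
      γ * bform P (closedLoop A b K *ᵥ x) (closedLoop A b K *ᵥ y) +
      r * ((K ⬝ᵥ x) * (K ⬝ᵥ y)) := by
  rw [feedbackStep, bform_add, bform_add, bform_smul, bform_smul, bform_conj, bform_vecMulVec]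

theorem isSymm_feedbackStep (hQ : Q.IsSymm) (hP : P.IsSymm) (K : Fin d → ℝ) :
    (feedbackStep A b Q γ r K P).IsSymm := by
  have : (feedbackStep A b Q γ r K P)ᵀ = feedbackStep A b Q γ r K P := by
    simp [feedbackStep, hQ.eq, hP.eq, Matrix.mul_assoc, Matrix.transpose_vecMulVec]
  exact this

theorem feedbackStep_nonneg (hγ : 0 ≤ γ) (hr : 0 ≤ r) (hQ : ∀ x, 0 ≤ bform Q x x)
    (hP : ∀ x, 0 ≤ bform P x x) (K x : Fin d → ℝ) :
    0 ≤ bform (feedbackStep A b Q γ r K P) x x := by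
  rw [bform_feedbackStep]
  have := hQ x
  have := mul_nonneg hγ (hP (closedLoop A b K *ᵥ x))
  have := mul_nonneg hr (mul_self_nonneg (K ⬝ᵥ x))
  linarith

theorem gain_dotProduct (x : Fin d → ℝ) :
    gain A b γ r P ⬝ᵥ x = -(γ / (r + γ * bform P b b)) * bform P b (A *ᵥ x) := by
  simp [gain, bform, Matrix.dotProduct_mulVec]

theorem weight_pos (hγ : 0 ≤ γ) (hr : 0 < r) (hP : ∀ x, 0 ≤ bform P x x) :
    0 < r + γ * bform P b b := by
  have := mul_nonneg hγ (hP b)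
  linarith

/-- This is half the derivative in `u` of the one-step cost, evaluated at the optimal control. All
later identities about the gain use it in place of the explicit formula. -/
theorem gain_optimality (h : r + γ * bform P b b ≠ 0) (x : Fin d → ℝ) :
    r * (gain A b γ r P ⬝ᵥ x) +
      γ * bform P b (closedLoop A b (gain A b γ r P) *ᵥ x) = 0 := by
  rw [closedLoop_mulVec, bform_add_right, bform_smul_right, gain_dotProduct]
  field_simp
  ring

/-- The one-step cost is quadratic in `u` with leading coefficient `r + γ bᵀ P b`, and the gain
gives its stationary point, so no linear term remains. -/
theorem complete_square (hP : P.IsSymm) (h : r + γ * bform P b b ≠ 0) (x : Fin d → ℝ) (u : ℝ) :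
    bform Q x x + r * u ^ 2 + γ * bform P (A *ᵥ x + u • b) (A *ᵥ x + u • b) =
      bform (riccatiStep A b Q γ r P) x x +
        (r + γ * bform P b b) * (u - gain A b γ r P ⬝ᵥ x) ^ 2 := by
  rw [riccatiStep, bform_feedbackStep, closedLoop_mulVec]
  have h1 := gain_optimality (A := A) h x
  rw [closedLoop_mulVec] at h1
  set k := gain A b γ r P ⬝ᵥ x
  simp only [bform_add_left, bform_add_right, bform_smul_left, bform_smul_right] at h1 ⊢
  rw [bform_symm hP (A *ᵥ x) b]
  linear_combination 2 * (u - k) * h1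

theorem riccatiStep_le (hγ : 0 ≤ γ) (hr : 0 < r) (hP : P.IsSymm) (hP0 : ∀ x, 0 ≤ bform P x x)
    (x : Fin d → ℝ) (u : ℝ) :
    bform (riccatiStep A b Q γ r P) x x ≤
      bform Q x x + r * u ^ 2 + γ * bform P (A *ᵥ x + u • b) (A *ᵥ x + u • b) := by
  have h := weight_pos (b := b) hγ hr hP0
  rw [complete_square hP h.ne']
  have := mul_nonneg h.le (sq_nonneg (u - gain A b γ r P ⬝ᵥ x))
  linarith

theorem bform_riccatiStep_self (x : Fin d → ℝ) :
    bform (riccatiStep A b Q γ r P) x x = bform Q x x + r * (gain A b γ r P ⬝ᵥ x) ^ 2 +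
      γ * bform P (A *ᵥ x + (gain A b γ r P ⬝ᵥ x) • b)
        (A *ᵥ x + (gain A b γ r P ⬝ᵥ x) • b) := by
  rw [riccatiStep, bform_feedbackStep, closedLoop_mulVec]
  ring

/-- The control that is optimal for `P'` is merely admissible for `P`. -/
theorem riccatiStep_mono (hγ : 0 ≤ γ) (hr : 0 < r) (hP : P.IsSymm)
    (hP0 : ∀ x, 0 ≤ bform P x x) {P' : Matrix (Fin d) (Fin d) ℝ}
    (hPP' : ∀ x, bform P x x ≤ bform P' x x) (x : Fin d → ℝ) :
    bform (riccatiStep A b Q γ r P) x x ≤ bform (riccatiStep A b Q γ r P') x x := by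
  rw [bform_riccatiStep_self (P := P')]
  refine (riccatiStep_le hγ hr hP hP0 x (gain A b γ r P' ⬝ᵥ x)).trans ?_
  gcongr
  exact hPP' _

/-- Two solutions of the Riccati equation, for two weights, satisfy a mixed Lyapunov equation. -/
theorem riccati_sub_riccati {s : ℝ} {P' : Matrix (Fin d) (Fin d) ℝ}
    (h : r + γ * bform P b b ≠ 0) (h' : s + γ * bform P' b b ≠ 0) (hP' : P'.IsSymm)
    (hPr : riccatiStep A b Q γ r P = P) (hPs : riccatiStep A b Q γ s P' = P') :
    (P - P') - γ • ((closedLoop A b (gain A b γ s P'))ᵀ * (P - P') *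
      closedLoop A b (gain A b γ r P)) =
      (r - s) • Matrix.vecMulVec (gain A b γ s P') (gain A b γ r P) := by
  refine ext_bform fun x y => ?_
  have e1 := congrArg (fun M => bform M x y) hPr
  have e2 := congrArg (fun M => bform M x y) hPs
  have o1 := gain_optimality (A := A) h y
  have o2 := gain_optimality (A := A) h' x
  simp only [riccatiStep, bform_feedbackStep] at e1 e2
  simp only [bform_sub, bform_smul, bform_conj, bform_vecMulVec]
  rw [bform_symm hP'] at o2
  rw [← e1, ← e2]
  simp only [closedLoop_mulVec] at o1 o2 ⊢
  simp only [bform_add_left, bform_add_right, bform_smul_left, bform_smul_right] at o1 o2 ⊢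
  -- The two closed loops differ by a multiple of `b`. Each optimality condition therefore permits
  -- changing the gain in one argument of its own Riccati equation: in `x` for `P`, in `y` for `P'`.
  -- Both equations then carry the same mixed pair of closed loops.
  linear_combination (gain A b γ r P ⬝ᵥ x - gain A b γ s P' ⬝ᵥ x) * o1 +
    (gain A b γ r P ⬝ᵥ y - gain A b γ s P' ⬝ᵥ y) * o2

end Step

/-! ### Value iteration and its limit. -/

/-- The iterates of the Riccati operator, from `0`. -/
def riccatiIter (A : Matrix (Fin d) (Fin d) ℝ) (b : Fin d → ℝ) (Q : Matrix (Fin d) (Fin d) ℝ)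
    (γ r : ℝ) : ℕ → Matrix (Fin d) (Fin d) ℝ
  | 0 => 0
  | n + 1 => riccatiStep A b Q γ r (riccatiIter A b Q γ r n)

/-- The iterates of the value iteration for the zero control, from `0`. -/
def freeIter (A : Matrix (Fin d) (Fin d) ℝ) (b : Fin d → ℝ) (Q : Matrix (Fin d) (Fin d) ℝ)
    (γ : ℝ) : ℕ → Matrix (Fin d) (Fin d) ℝ
  | 0 => 0
  | n + 1 => feedbackStep A b Q γ 0 0 (freeIter A b Q γ n)

/-- The limit of the iterates of the Riccati operator. -/
def riccatiLimit (A : Matrix (Fin d) (Fin d) ℝ) (b : Fin d → ℝ) (Q : Matrix (Fin d) (Fin d) ℝ)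
    (γ r : ℝ) : Matrix (Fin d) (Fin d) ℝ :=
  limUnder atTop (riccatiIter A b Q γ r)

section Iter

variable {A : Matrix (Fin d) (Fin d) ℝ} {b : Fin d → ℝ} {Q : Matrix (Fin d) (Fin d) ℝ}
  {γ r : ℝ}

theorem isSymm_riccatiIter (hQ : Q.IsSymm) (n : ℕ) : (riccatiIter A b Q γ r n).IsSymm := by
  induction n with
  | zero => exact Matrix.isSymm_zero
  | succ n ih => exact isSymm_feedbackStep hQ ih _

theorem riccatiIter_nonneg (hγ : 0 ≤ γ) (hr : 0 ≤ r) (hQ : ∀ x, 0 ≤ bform Q x x) (n : ℕ)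
    (x : Fin d → ℝ) : 0 ≤ bform (riccatiIter A b Q γ r n) x x := by
  induction n generalizing x with
  | zero => simp [riccatiIter]
  | succ n ih => exact feedbackStep_nonneg hγ hr hQ ih _ _

theorem freeIter_nonneg (hγ : 0 ≤ γ) (hQ : ∀ x, 0 ≤ bform Q x x) (n : ℕ)
    (x : Fin d → ℝ) : 0 ≤ bform (freeIter A b Q γ n) x x := by
  induction n generalizing x with
  | zero => simp [freeIter]
  | succ n ih => exact feedbackStep_nonneg hγ le_rfl hQ ih _ _

theorem riccatiIter_mono (hγ : 0 ≤ γ) (hr : 0 < r) (hQ : Q.IsSymm)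
    (hQ0 : ∀ x, 0 ≤ bform Q x x) (x : Fin d → ℝ) :
    Monotone fun n => bform (riccatiIter A b Q γ r n) x x := by
  refine monotone_nat_of_le_succ fun n => ?_
  induction n generalizing x with
  | zero =>
    have := riccatiIter_nonneg (A := A) (b := b) hγ hr.le hQ0 1 x
    simpa [riccatiIter] using this
  | succ n ih =>
    exact riccatiStep_mono hγ hr (isSymm_riccatiIter hQ n)
      (riccatiIter_nonneg hγ hr.le hQ0 n) ih x

theorem bddAbove_riccatiIter_of_next (hγ : 0 ≤ γ) (hr : 0 < r) (hQ : Q.IsSymm)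
    (hQ0 : ∀ x, 0 ≤ bform Q x x) (x : Fin d → ℝ) (u : ℝ)
    (h : BddAbove (range fun n =>
      bform (riccatiIter A b Q γ r n) (A *ᵥ x + u • b) (A *ᵥ x + u • b))) :
    BddAbove (range fun n => bform (riccatiIter A b Q γ r n) x x) := by
  obtain ⟨M, hM⟩ := h
  refine ⟨bform Q x x + r * u ^ 2 + γ * M, ?_⟩
  rintro _ ⟨n, rfl⟩
  refine (riccatiIter_mono hγ hr hQ hQ0 x n.le_succ).trans ?_
  refine (riccatiStep_le hγ hr (isSymm_riccatiIter hQ n)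
    (riccatiIter_nonneg hγ hr.le hQ0 n) x u).trans ?_
  gcongr
  exact hM ⟨n, rfl⟩

/-- Under the span condition the noiseless system can be steered from `x` to `0` in `m` steps, at a
finite cost that does not depend on the horizon. -/
theorem bddAbove_riccatiIter_of_mem_span (hγ : 0 ≤ γ) (hr : 0 < r) (hQ : Q.IsSymm)
    (hQ0 : ∀ x, 0 ≤ bform Q x x) (m : ℕ) (x : Fin d → ℝ)
    (hx : (A ^ m) *ᵥ x ∈ Submodule.span ℝ ((fun k : ℕ => (A ^ k) *ᵥ b) '' Set.Iio m)) :
    BddAbove (range fun n => bform (riccatiIter A b Q γ r n) x x) := by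
  induction m generalizing x with
  | zero =>
    obtain rfl : x = 0 := by simpa using hx
    exact ⟨0, by rintro _ ⟨n, rfl⟩; simp⟩
  | succ m ih =>
    rw [← Order.succ_eq_add_one, Order.Iio_succ_eq_insert, image_insert_eq,
      Submodule.mem_span_insert] at hx
    obtain ⟨c, z, hz, h⟩ := hx
    -- Here `c` is the coefficient of `A ^ m *ᵥ b` in `A ^ (m + 1) *ᵥ x`. The control `-c` removes
    -- it, leaving a state whose image under `A ^ m` is `z`.
    refine bddAbove_riccatiIter_of_next hγ hr hQ hQ0 x (-c) (ih _ ?_)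
    convert hz using 1
    rw [Order.succ_eq_add_one, pow_succ, ← Matrix.mulVec_mulVec] at h
    rw [Matrix.mulVec_add, h, Matrix.mulVec_smul]
    simp

theorem bddAbove_riccatiIter (hγ : 0 ≤ γ) (hr : 0 < r) (hQ : Q.IsSymm)
    (hQ0 : ∀ x, 0 ≤ bform Q x x) (hctrl : Controllable A b) (x : Fin d → ℝ) :
    BddAbove (range fun n => bform (riccatiIter A b Q γ r n) x x) := by
  refine bddAbove_riccatiIter_of_mem_span hγ hr hQ hQ0 d x ?_
  have : ((fun k : ℕ => (A ^ k) *ᵥ b) '' Set.Iio d) =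
      Set.range fun k : Fin d => (A ^ (k : ℕ)) *ᵥ b := by
    ext y
    constructor
    · rintro ⟨k, hk, rfl⟩
      exact ⟨⟨k, hk⟩, rfl⟩
    · rintro ⟨k, rfl⟩
      exact ⟨k, k.2, rfl⟩
  rw [this, hctrl]
  trivial

/-- Each quadratic form value is monotone and bounded; polarization turns this into convergence of
every entry. -/
theorem tendsto_riccatiIter (hγ : 0 ≤ γ) (hr : 0 < r) (hQ : Q.IsSymm)
    (hQ0 : ∀ x, 0 ≤ bform Q x x) (hctrl : Controllable A b) :
    Tendsto (riccatiIter A b Q γ r) atTop (𝓝 (riccatiLimit A b Q γ r)) := by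
  refine tendsto_nhds_limUnder ?_
  have h1 : ∀ x, ∃ a, Tendsto (fun n => bform (riccatiIter A b Q γ r n) x x) atTop (𝓝 a) :=
    fun x => ⟨_, tendsto_atTop_ciSup (riccatiIter_mono hγ hr hQ hQ0 x)
      (bddAbove_riccatiIter hγ hr hQ hQ0 hctrl x)⟩
  choose q hq using h1
  refine ⟨Matrix.of fun i j => (q (Pi.single i 1 + Pi.single j 1) - q (Pi.single i 1) -
    q (Pi.single j 1)) / 2, ?_⟩
  refine tendsto_pi_nhds.2 fun i => tendsto_pi_nhds.2 fun j => ?_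
  refine Tendsto.congr (fun n => ?_) ((((hq _).sub (hq _)).sub (hq _)).div_const 2)
  rw [← bform_polarization (isSymm_riccatiIter hQ n), bform_single]

theorem isSymm_riccatiLimit (hγ : 0 ≤ γ) (hr : 0 < r) (hQ : Q.IsSymm)
    (hQ0 : ∀ x, 0 ≤ bform Q x x) (hctrl : Controllable A b) :
    (riccatiLimit A b Q γ r).IsSymm := by
  have h := tendsto_riccatiIter hγ hr hQ hQ0 hctrl
  refine Matrix.IsSymm.ext fun i j => ?_
  refine tendsto_nhds_unique ?_ (tendsto_pi_nhds.1 (tendsto_pi_nhds.1 h i) j)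
  refine (tendsto_pi_nhds.1 (tendsto_pi_nhds.1 h j) i).congr fun n => ?_
  exact (isSymm_riccatiIter hQ n).apply i j

theorem tendsto_bform_riccatiIter (hγ : 0 ≤ γ) (hr : 0 < r) (hQ : Q.IsSymm)
    (hQ0 : ∀ x, 0 ≤ bform Q x x) (hctrl : Controllable A b) (x y : Fin d → ℝ) :
    Tendsto (fun n => bform (riccatiIter A b Q γ r n) x y) atTop
      (𝓝 (bform (riccatiLimit A b Q γ r) x y)) :=
  ((continuous_bform x y).tendsto _).comp (tendsto_riccatiIter hγ hr hQ hQ0 hctrl)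

theorem riccatiLimit_nonneg (hγ : 0 ≤ γ) (hr : 0 < r) (hQ : Q.IsSymm)
    (hQ0 : ∀ x, 0 ≤ bform Q x x) (hctrl : Controllable A b) (x : Fin d → ℝ) :
    0 ≤ bform (riccatiLimit A b Q γ r) x x :=
  ge_of_tendsto' (tendsto_bform_riccatiIter hγ hr hQ hQ0 hctrl x x)
    fun n => riccatiIter_nonneg hγ hr.le hQ0 n x

theorem tendsto_closedLoop {ι : Type*} {l : Filter ι} {K : ι → Fin d → ℝ} {k : Fin d → ℝ}
    (hK : Tendsto K l (𝓝 k)) :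
    Tendsto (fun i => closedLoop A b (K i)) l (𝓝 (closedLoop A b k)) := by
  have c : Continuous fun k : Fin d → ℝ => A + Matrix.vecMulVec b k :=
    continuous_const.add (Continuous.matrix_vecMulVec continuous_const continuous_id)
  exact (c.tendsto k).comp hK

theorem tendsto_feedbackStep {ι : Type*} {l : Filter ι} {K : ι → Fin d → ℝ} {k : Fin d → ℝ}
    {R : ι → Matrix (Fin d) (Fin d) ℝ} {P : Matrix (Fin d) (Fin d) ℝ} {ρ : ι → ℝ}
    (hρ : Tendsto (fun i => ρ i • Matrix.vecMulVec (K i) (K i)) l (𝓝 (r • Matrix.vecMulVec k k)))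
    (hK : Tendsto K l (𝓝 k)) (hR : Tendsto R l (𝓝 P)) :
    Tendsto (fun i => feedbackStep A b Q γ (ρ i) (K i) (R i)) l
      (𝓝 (feedbackStep A b Q γ r k P)) := by
  have hL := tendsto_closedLoop (A := A) (b := b) hK
  have hT : Tendsto (fun i => (closedLoop A b (K i))ᵀ) l (𝓝 (closedLoop A b k)ᵀ) :=
    (continuous_id.matrix_transpose.tendsto (closedLoop A b k)).comp hL
  exact (tendsto_const_nhds.add (((hT.mul hR).mul hL).const_smul γ)).add hρ

theorem tendsto_vecMulVec {ι : Type*} {l : Filter ι} {K L : ι → Fin d → ℝ} {k k' : Fin d → ℝ}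
    (hK : Tendsto K l (𝓝 k)) (hL : Tendsto L l (𝓝 k')) :
    Tendsto (fun i => Matrix.vecMulVec (K i) (L i)) l (𝓝 (Matrix.vecMulVec k k')) :=
  tendsto_pi_nhds.2 fun i => tendsto_pi_nhds.2 fun j =>
    (tendsto_pi_nhds.1 hK i).mul (tendsto_pi_nhds.1 hL j)

theorem tendsto_gain {ι : Type*} {l : Filter ι} {ρ : ι → ℝ} {R : ι → Matrix (Fin d) (Fin d) ℝ}
    {P : Matrix (Fin d) (Fin d) ℝ} (hρ : Tendsto ρ l (𝓝 r)) (hR : Tendsto R l (𝓝 P))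
    (h : r + γ * bform P b b ≠ 0) :
    Tendsto (fun i => gain A b γ (ρ i) (R i)) l (𝓝 (gain A b γ r P)) := by
  have c1 : Continuous fun R : Matrix (Fin d) (Fin d) ℝ => b ᵥ* (R * A) :=
    continuous_const.matrix_vecMul (continuous_id.matrix_mul continuous_const)
  have h1 : Tendsto (fun i => b ᵥ* (R i * A)) l (𝓝 (b ᵥ* (P * A))) := (c1.tendsto P).comp hR
  have h2 : Tendsto (fun i => bform (R i) b b) l (𝓝 (bform P b b)) :=
    ((continuous_bform b b).tendsto P).comp hR
  have h3 : Tendsto (fun i => γ / (ρ i + γ * bform (R i) b b)) l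
      (𝓝 (γ / (r + γ * bform P b b))) :=
    tendsto_const_nhds.div (hρ.add (h2.const_mul γ)) h
  exact (h3.smul h1).neg

theorem tendsto_riccatiStep {ι : Type*} {l : Filter ι} {R : ι → Matrix (Fin d) (Fin d) ℝ}
    {P : Matrix (Fin d) (Fin d) ℝ} (hR : Tendsto R l (𝓝 P)) (h : r + γ * bform P b b ≠ 0) :
    Tendsto (fun i => riccatiStep A b Q γ r (R i)) l (𝓝 (riccatiStep A b Q γ r P)) := by
  have hg : Tendsto (fun i => gain A b γ r (R i)) l (𝓝 (gain A b γ r P)) :=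
    tendsto_gain tendsto_const_nhds hR h
  exact tendsto_feedbackStep ((tendsto_vecMulVec hg hg).const_smul r) hg hR

theorem riccatiStep_riccatiLimit (hγ : 0 ≤ γ) (hr : 0 < r) (hQ : Q.IsSymm)
    (hQ0 : ∀ x, 0 ≤ bform Q x x) (hctrl : Controllable A b) :
    riccatiStep A b Q γ r (riccatiLimit A b Q γ r) = riccatiLimit A b Q γ r := by
  have h := tendsto_riccatiIter hγ hr hQ hQ0 hctrl
  exact tendsto_nhds_unique (tendsto_riccatiStep h (weight_pos hγ hr
    (riccatiLimit_nonneg hγ hr hQ hQ0 hctrl)).ne') ((tendsto_add_atTop_iff_nat 1).2 h)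

end Iter

/-! ### Integrals over the path measure. -/

section Path

variable (A : Matrix (Fin d) (Fin d) ℝ) (b : Fin d → ℝ) (F : Measure (Fin d → ℝ))
  [IsProbabilityMeasure F] (π : Policy d) (x : Fin d → ℝ)

instance : IsProbabilityMeasure (pathMeasure A b F π x) := by
  unfold pathMeasure; infer_instance

theorem lintegral_pathMeasure_succ (t : ℕ)
    {f : (Finset.Iic t → (Fin d → ℝ) × ℝ) × ((Fin d → ℝ) × ℝ) → ℝ≥0∞} (hf : Measurable f) :
    ∫⁻ ω, f (Preorder.frestrictLe t ω, ω (t + 1)) ∂(pathMeasure A b F π x) =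
      ∫⁻ ω, ∫⁻ y, f (Preorder.frestrictLe t ω, y)
        ∂(transition A b F π t (Preorder.frestrictLe t ω)) ∂(pathMeasure A b F π x) := by
  have h := Kernel.map_frestrictLe_trajMeasure_compProd_eq_map_trajMeasure
    (X := fun _ => (Fin d → ℝ) × ℝ) (μ₀ := initial π x) (κ := transition A b F π) (a := t)
  have h1 := congrArg (fun ν => ∫⁻ z, f z ∂ν) h
  rw [lintegral_map hf (by fun_prop)] at h1
  unfold pathMeasure
  rw [← h1, Measure.lintegral_compProd hf, lintegral_map (by fun_prop) (by fun_prop)]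

theorem lintegral_pathMeasure_zero {f : (Fin d → ℝ) × ℝ → ℝ≥0∞} (hf : Measurable f) :
    ∫⁻ ω, f (ω 0) ∂(pathMeasure A b F π x) = ∫⁻ z, f z ∂(initial π x) := by
  unfold pathMeasure Kernel.trajMeasure
  have hm : Measurable fun ω : ℕ → (Fin d → ℝ) × ℝ => f (ω 0) := by fun_prop
  rw [Measure.lintegral_bind (by fun_prop) hm.aemeasurable, lintegral_map (by fun_prop) (by fun_prop)]
  refine lintegral_congr fun z => ?_
  have h := Kernel.traj_map_frestrictLe_apply (X := fun _ => (Fin d → ℝ) × ℝ)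
    (κ := transition A b F π) 0 0
    ((MeasurableEquiv.piUnique fun _ : Finset.Iic 0 => (Fin d → ℝ) × ℝ).symm z)
  have h1 := congrArg (fun ν => ∫⁻ h, f (h ⟨0, Finset.mem_Iic.2 le_rfl⟩) ∂ν) h
  simp only [Kernel.partialTraj_self, Kernel.id_apply] at h1
  rw [lintegral_map (by fun_prop) (by fun_prop), lintegral_dirac' _ (by fun_prop)] at h1
  exact h1

theorem lintegral_pathMeasure_state_zero {g : (Fin d → ℝ) → ℝ≥0∞} (hg : Measurable g) :
    ∫⁻ ω, g (ω 0).1 ∂(pathMeasure A b F π x) = g x := by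
  rw [lintegral_pathMeasure_zero A b F π x (f := fun z => g z.1) (by fun_prop), initial,
    lintegral_map (by fun_prop) (by fun_prop)]
  simp

theorem lintegral_stateKernel (t : ℕ) (h : Finset.Iic t → (Fin d → ℝ) × ℝ)
    {g : (Fin d → ℝ) → ℝ≥0∞} (hg : Measurable g) :
    ∫⁻ y, g y ∂(stateKernel A b F t h) = ∫⁻ n, g (nextState A b t (h, n)) ∂F := by
  have := measurable_nextState A b t
  rw [stateKernel, Kernel.lintegral_map _ this _ hg,
    Kernel.lintegral_id_prod (f := fun p => g (nextState A b t p)) (by fun_prop)]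
  simp

theorem lintegral_pathMeasure_state_succ (t : ℕ) {g : (Fin d → ℝ) → ℝ≥0∞} (hg : Measurable g) :
    ∫⁻ ω, g (ω (t + 1)).1 ∂(pathMeasure A b F π x) =
      ∫⁻ ω, ∫⁻ n, g (A *ᵥ (ω t).1 + (ω t).2 • b + n) ∂F ∂(pathMeasure A b F π x) := by
  rw [lintegral_pathMeasure_succ A b F π x t (f := fun p => g p.2.1) (by fun_prop)]
  refine lintegral_congr fun ω => ?_
  rw [transition, Kernel.lintegral_compProd _ _ _ (f := fun y => g y.1) (by fun_prop)]
  simp only [lintegral_const, measure_univ, mul_one]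
  exact lintegral_stateKernel A b F t _ hg

variable {π} {K : Fin d → ℝ}

/-- The control coordinate almost surely equals the feedback value. The statement is phrased through
integrals because that is how dynamic programming uses it. -/
theorem lintegral_pathMeasure_feedback
    (hπ : ∀ t p, π.law t p = Measure.dirac (K ⬝ᵥ p.2)) (t : ℕ)
    {f : (Fin d → ℝ) × ℝ → ℝ≥0∞} (hf : Measurable f) :
    ∫⁻ ω, f (ω t) ∂(pathMeasure A b F π x) =
      ∫⁻ ω, f ((ω t).1, K ⬝ᵥ (ω t).1) ∂(pathMeasure A b F π x) := by
  have hK : Measurable fun y : Fin d → ℝ => K ⬝ᵥ y :=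
    (Continuous.dotProduct continuous_const continuous_id).measurable
  have hf' : Measurable fun z : (Fin d → ℝ) × ℝ => f (z.1, K ⬝ᵥ z.1) := by fun_prop
  cases t with
  | zero =>
    rw [lintegral_pathMeasure_zero A b F π x hf, lintegral_pathMeasure_zero A b F π x hf',
      initial, lintegral_map hf (by fun_prop), lintegral_map hf' (by fun_prop), hπ]
    rw [lintegral_dirac' _ (by fun_prop), lintegral_dirac' _ (by fun_prop)]
  | succ t =>
    rw [lintegral_pathMeasure_succ A b F π x t (f := fun p => f p.2) (by fun_prop),
      lintegral_pathMeasure_succ A b F π x t (f := fun p => f (p.2.1, K ⬝ᵥ p.2.1)) (by fun_prop)]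
    refine lintegral_congr fun ω => ?_
    rw [transition, Kernel.lintegral_compProd _ _ _ hf, Kernel.lintegral_compProd _ _ _ hf']
    refine lintegral_congr fun y => ?_
    rw [controlKernel, Kernel.comap_apply, hπ, lintegral_dirac' _ (by fun_prop),
      lintegral_dirac' _ (by fun_prop)]
    rfl

end Path

/-- The linear feedback policy `u = K ⬝ᵥ x`. -/
def feedbackPolicy (K : Fin d → ℝ) : Policy d where
  law _ := Kernel.deterministic (fun p => K ⬝ᵥ p.2)
    ((Continuous.dotProduct continuous_const continuous_id).measurable.comp measurable_snd)
  markov _ := inferInstance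

theorem feedbackPolicy_law (K : Fin d → ℝ) (t : ℕ)
    (p : (Finset.Iio t → (Fin d → ℝ) × ℝ) × (Fin d → ℝ)) :
    (feedbackPolicy K).law t p = Measure.dirac (K ⬝ᵥ p.2) := by
  simp [feedbackPolicy, Kernel.deterministic_apply]

theorem zeroPolicy_law (t : ℕ) (p : (Finset.Iio t → (Fin d → ℝ) × ℝ) × (Fin d → ℝ)) :
    (zeroPolicy d).law t p = Measure.dirac ((0 : Fin d → ℝ) ⬝ᵥ p.2) := by
  simp [zeroPolicy]

/-- The one-stage cost. -/
def stageCost (Q : Matrix (Fin d) (Fin d) ℝ) (r : ℝ) (z : (Fin d → ℝ) × ℝ) : ℝ≥0∞ :=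
  ENNReal.ofReal (bform Q z.1 z.1 + r * z.2 ^ 2)

@[fun_prop]
theorem measurable_stageCost (Q : Matrix (Fin d) (Fin d) ℝ) (r : ℝ) :
    Measurable (stageCost Q r) := by
  have h : Measurable fun x : Fin d → ℝ => bform Q x x := (continuous_bform_self Q).measurable
  have h' : Measurable fun z : (Fin d → ℝ) × ℝ => bform Q z.1 z.1 := h.comp measurable_fst
  unfold stageCost
  fun_prop

/-! ### Verification by dynamic programming. -/

section DynamicProgramming

variable (A : Matrix (Fin d) (Fin d) ℝ) (b : Fin d → ℝ) (F : Measure (Fin d → ℝ))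
  [IsProbabilityMeasure F] (Q : Matrix (Fin d) (Fin d) ℝ) (γ r : ℝ) (π : Policy d)
  (x : Fin d → ℝ)

theorem cost_eq_tsum (hγ : 0 ≤ γ) :
    cost A b F Q γ r π x = ∑' t : ℕ, ENNReal.ofReal γ ^ t *
      ∫⁻ ω, stageCost Q r (ω t) ∂(pathMeasure A b F π x) := by
  have h : ∀ (t : ℕ) (ω : ℕ → (Fin d → ℝ) × ℝ),
      ENNReal.ofReal (γ ^ t * ((ω t).1 ⬝ᵥ (Q *ᵥ (ω t).1) + r * (ω t).2 ^ 2)) =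
        ENNReal.ofReal γ ^ t * stageCost Q r (ω t) := fun t ω => by
    rw [ENNReal.ofReal_mul (pow_nonneg hγ t), ENNReal.ofReal_pow hγ, stageCost, bform]
  unfold cost
  simp only [h]
  rw [lintegral_tsum fun t => Measurable.aemeasurable (by fun_prop)]
  exact tsum_congr fun t => lintegral_const_mul _ (by fun_prop)

variable {A b F Q γ r π x}

/-- The Bellman inequality is iterated along the path. `N` counts stages to go and `t` is the
current time, so the induction on `N` must leave `t` free. -/
theorem lintegral_value_le_sum {V : ℕ → (Fin d → ℝ) → ℝ≥0∞} (hm : ∀ n, Measurable (V n))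
    (h0 : ∀ y, V 0 y = 0)
    (hV : ∀ n y u, V (n + 1) y ≤ stageCost Q r (y, u) +
      ENNReal.ofReal γ * ∫⁻ w, V n (A *ᵥ y + u • b + w) ∂F) (N t : ℕ) :
    ∫⁻ ω, V N (ω t).1 ∂(pathMeasure A b F π x) ≤
      ∑ k ∈ Finset.range N, ENNReal.ofReal γ ^ k *
        ∫⁻ ω, stageCost Q r (ω (t + k)) ∂(pathMeasure A b F π x) := by
  induction N generalizing t with
  | zero => simp [h0]
  | succ N ih =>
    have hN := hm N
    have hc : Continuous fun z : (Fin d → ℝ) × ℝ => A *ᵥ z.1 + z.2 • b :=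
      (Continuous.matrix_mulVec continuous_const continuous_fst).add (by fun_prop)
    have hc' := hc.measurable
    have hg : Measurable fun ω : ℕ → (Fin d → ℝ) × ℝ =>
        ∫⁻ w, V N (A *ᵥ (ω t).1 + (ω t).2 • b + w) ∂F := by
      refine Measurable.lintegral_prod_right' (f := fun p : (ℕ → (Fin d → ℝ) × ℝ) × (Fin d → ℝ) =>
        V N (A *ᵥ (p.1 t).1 + (p.1 t).2 • b + p.2)) (hN.comp ?_)
      exact (hc'.comp (by fun_prop : Measurable fun p : (ℕ → (Fin d → ℝ) × ℝ) × (Fin d → ℝ) =>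
        p.1 t)).add measurable_snd
    calc ∫⁻ ω, V (N + 1) (ω t).1 ∂(pathMeasure A b F π x)
        ≤ ∫⁻ ω, (stageCost Q r (ω t) + ENNReal.ofReal γ *
            ∫⁻ w, V N (A *ᵥ (ω t).1 + (ω t).2 • b + w) ∂F) ∂(pathMeasure A b F π x) :=
          lintegral_mono fun ω => hV N _ _
      _ = ∫⁻ ω, stageCost Q r (ω t) ∂(pathMeasure A b F π x) +
            ENNReal.ofReal γ * ∫⁻ ω, V N (ω (t + 1)).1 ∂(pathMeasure A b F π x) := by
          rw [lintegral_add_left (by fun_prop), lintegral_const_mul _ hg,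
            lintegral_pathMeasure_state_succ A b F π x t hN]
      _ ≤ _ := by
          rw [Finset.sum_range_succ', add_comm]
          simp only [pow_zero, one_mul, add_zero]
          gcongr
          refine (mul_le_mul_right (ih (t + 1)) _).trans ?_
          rw [Finset.mul_sum]
          refine Finset.sum_le_sum fun k _ => ?_
          rw [← mul_assoc, ← pow_succ', add_right_comm, add_assoc]

theorem value_le_cost (hγ : 0 ≤ γ) {V : ℕ → (Fin d → ℝ) → ℝ≥0∞} (hm : ∀ n, Measurable (V n))
    (h0 : ∀ y, V 0 y = 0)
    (hV : ∀ n y u, V (n + 1) y ≤ stageCost Q r (y, u) +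
      ENNReal.ofReal γ * ∫⁻ w, V n (A *ᵥ y + u • b + w) ∂F) (N : ℕ) :
    V N x ≤ cost A b F Q γ r π x := by
  rw [cost_eq_tsum _ _ _ _ _ _ _ _ hγ, ← lintegral_pathMeasure_state_zero A b F π x (hm N)]
  refine (lintegral_value_le_sum hm h0 hV N 0).trans ?_
  simp only [zero_add]
  exact ENNReal.sum_le_tsum _

theorem sum_le_lintegral_value {K : Fin d → ℝ}
    (hπ : ∀ t p, π.law t p = Measure.dirac (K ⬝ᵥ p.2))
    {V : ℕ → (Fin d → ℝ) → ℝ≥0∞} (hm : ∀ n, Measurable (V n))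
    (hV : ∀ n y, stageCost Q r (y, K ⬝ᵥ y) +
      ENNReal.ofReal γ * ∫⁻ w, V n (A *ᵥ y + (K ⬝ᵥ y) • b + w) ∂F ≤ V (n + 1) y) (N t : ℕ) :
    ∑ k ∈ Finset.range N, ENNReal.ofReal γ ^ k *
        ∫⁻ ω, stageCost Q r (ω (t + k)) ∂(pathMeasure A b F π x) ≤
      ∫⁻ ω, V N (ω t).1 ∂(pathMeasure A b F π x) := by
  induction N generalizing t with
  | zero => simp
  | succ N ih =>
    have hN := hm N
    have hc : Continuous fun z : (Fin d → ℝ) × ℝ => A *ᵥ z.1 + z.2 • b :=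
      (Continuous.matrix_mulVec continuous_const continuous_fst).add (by fun_prop)
    have hc' := hc.measurable
    have hK : Measurable fun y : Fin d → ℝ => K ⬝ᵥ y :=
      (Continuous.dotProduct continuous_const continuous_id).measurable
    have hg : Measurable fun z : (Fin d → ℝ) × ℝ =>
        ∫⁻ w, V N (A *ᵥ z.1 + z.2 • b + w) ∂F := by
      refine Measurable.lintegral_prod_right' (f := fun p : ((Fin d → ℝ) × ℝ) × (Fin d → ℝ) =>
        V N (A *ᵥ p.1.1 + p.1.2 • b + p.2)) (hN.comp ?_)
      exact (hc'.comp measurable_fst).add measurable_snd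
    calc _ ≤ ∫⁻ ω, stageCost Q r (ω t) ∂(pathMeasure A b F π x) +
            ENNReal.ofReal γ * ∫⁻ ω, V N (ω (t + 1)).1 ∂(pathMeasure A b F π x) := by
          rw [Finset.sum_range_succ', add_comm]
          simp only [pow_zero, one_mul, add_zero]
          gcongr
          refine le_trans (le_of_eq ?_) (mul_le_mul_right (ih (t + 1)) _)
          rw [Finset.mul_sum]
          refine Finset.sum_congr rfl fun k _ => ?_
          rw [← mul_assoc, ← pow_succ', add_right_comm, add_assoc]
      _ = ∫⁻ ω, (stageCost Q r (ω t) + ENNReal.ofReal γ *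
            ∫⁻ w, V N (A *ᵥ (ω t).1 + (ω t).2 • b + w) ∂F) ∂(pathMeasure A b F π x) := by
          rw [lintegral_add_left (by fun_prop), lintegral_const_mul _ (by fun_prop),
            lintegral_pathMeasure_state_succ A b F π x t hN]
      _ = ∫⁻ ω, (stageCost Q r ((ω t).1, K ⬝ᵥ (ω t).1) + ENNReal.ofReal γ *
            ∫⁻ w, V N (A *ᵥ (ω t).1 + (K ⬝ᵥ (ω t).1) • b + w) ∂F) ∂(pathMeasure A b F π x) :=
          lintegral_pathMeasure_feedback A b F x hπ t
            (f := fun z => stageCost Q r z + ENNReal.ofReal γ *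
              ∫⁻ w, V N (A *ᵥ z.1 + z.2 • b + w) ∂F) (by fun_prop)
      _ ≤ _ := lintegral_mono fun ω => hV N _

/-- The reverse Bellman inequality is needed only along the feedback itself. It serves both the
optimal feedback, with a stationary `V`, and zero control, with finite-horizon values. -/
theorem cost_le_of_value_le (hγ : 0 ≤ γ) {K : Fin d → ℝ}
    (hπ : ∀ t p, π.law t p = Measure.dirac (K ⬝ᵥ p.2))
    {V : ℕ → (Fin d → ℝ) → ℝ≥0∞} (hm : ∀ n, Measurable (V n))
    (hV : ∀ n y, stageCost Q r (y, K ⬝ᵥ y) +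
      ENNReal.ofReal γ * ∫⁻ w, V n (A *ᵥ y + (K ⬝ᵥ y) • b + w) ∂F ≤ V (n + 1) y)
    {M : ℝ≥0∞} (hM : ∀ n, V n x ≤ M) :
    cost A b F Q γ r π x ≤ M := by
  rw [cost_eq_tsum _ _ _ _ _ _ _ _ hγ, ENNReal.tsum_eq_iSup_nat]
  refine iSup_le fun N => ?_
  have := sum_le_lintegral_value (x := x) hπ hm hV N 0
  simp only [zero_add] at this
  refine this.trans ?_
  rw [lintegral_pathMeasure_state_zero A b F π x (hm N)]
  exact hM N

end DynamicProgramming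

/-! ### Expectations of quadratic forms of the disturbance. -/

/-- The mean `E nᵀ P n` of a quadratic form of the disturbance. -/
def noiseCost (F : Measure (Fin d → ℝ)) (P : Matrix (Fin d) (Fin d) ℝ) : ℝ :=
  ∫ n, bform P n n ∂F

section Noise

variable {F : Measure (Fin d → ℝ)}

theorem bform_eq_sum (P : Matrix (Fin d) (Fin d) ℝ) (x y : Fin d → ℝ) :
    bform P x y = ∑ i, ∑ j, P i j * (x i * y j) := by
  simp only [bform, dotProduct, Matrix.mulVec, Finset.mul_sum]
  exact Finset.sum_congr rfl fun i _ => Finset.sum_congr rfl fun j _ => by ring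

theorem integrable_mul_coord (hF2 : ∀ i, MemLp (fun n : Fin d → ℝ => n i) 2 F) (i j : Fin d) :
    Integrable (fun n : Fin d → ℝ => n i * n j) F :=
  (hF2 i).integrable_mul (hF2 j)

theorem integrable_bform_self (hF2 : ∀ i, MemLp (fun n : Fin d → ℝ => n i) 2 F)
    (P : Matrix (Fin d) (Fin d) ℝ) : Integrable (fun n => bform P n n) F := by
  simp only [bform_eq_sum]
  exact integrable_finsetSum _ fun i _ => integrable_finsetSum _ fun j _ =>
    (integrable_mul_coord hF2 i j).const_mul _

theorem noiseCost_eq_sum (hF2 : ∀ i, MemLp (fun n : Fin d → ℝ => n i) 2 F)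
    (P : Matrix (Fin d) (Fin d) ℝ) :
    noiseCost F P = ∑ i, ∑ j, P i j * ∫ n, n i * n j ∂F := by
  have h1 : ∀ i j, Integrable (fun n : Fin d → ℝ => P i j * (n i * n j)) F := fun i j =>
    (integrable_mul_coord hF2 i j).const_mul _
  have h2 : noiseCost F P = ∫ n, ∑ i, ∑ j, P i j * (n i * n j) ∂F :=
    integral_congr_ae (ae_of_all _ fun n => bform_eq_sum P n n)
  rw [h2]
  refine (integral_finsetSum _ fun i _ => integrable_finsetSum _ fun j _ => h1 i j).trans ?_
  refine Finset.sum_congr rfl fun i _ => (integral_finsetSum _ fun j _ => h1 i j).trans ?_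
  exact Finset.sum_congr rfl fun j _ => integral_const_mul _ _

theorem noiseCost_nonneg {P : Matrix (Fin d) (Fin d) ℝ} (hP : ∀ x, 0 ≤ bform P x x) :
    0 ≤ noiseCost F P := integral_nonneg fun n => hP n

theorem noiseCost_mono (hF2 : ∀ i, MemLp (fun n : Fin d → ℝ => n i) 2 F)
    {P P' : Matrix (Fin d) (Fin d) ℝ} (h : ∀ x, bform P x x ≤ bform P' x x) :
    noiseCost F P ≤ noiseCost F P' :=
  integral_mono (integrable_bform_self hF2 P) (integrable_bform_self hF2 P') fun n => h n

theorem continuous_noiseCost (hF2 : ∀ i, MemLp (fun n : Fin d → ℝ => n i) 2 F) :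
    Continuous (noiseCost F) := by
  have : noiseCost F = fun P => ∑ i, ∑ j, P i j * ∫ n, n i * n j ∂F :=
    funext (noiseCost_eq_sum hF2)
  rw [this]
  exact continuous_finsetSum _ fun i _ => continuous_finsetSum _ fun j _ =>
    (continuous_id.matrix_elem i j).mul continuous_const

/-- Expanding the square leaves a term linear in the disturbance, which has mean zero. -/
theorem integral_bform_add [IsProbabilityMeasure F]
    (hF2 : ∀ i, MemLp (fun n : Fin d → ℝ => n i) 2 F)
    (hF0 : ∀ i, ∫ n, n i ∂F = 0) (P : Matrix (Fin d) (Fin d) ℝ) (y : Fin d → ℝ) (c : ℝ) :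
    Integrable (fun n => bform P (y + n) (y + n) + c) F ∧
    ∫ n, (bform P (y + n) (y + n) + c) ∂F = bform P y y + noiseCost F P + c := by
  have hi : ∀ i, Integrable (fun n : Fin d → ℝ => n i) F := fun i =>
    (hF2 i).integrable (by norm_num)
  have h1 : ∀ v : Fin d → ℝ, Integrable (fun n : Fin d → ℝ => v ⬝ᵥ n) F ∧
      ∫ n, v ⬝ᵥ n ∂F = 0 := fun v => by
    constructor
    · exact integrable_finsetSum _ fun i _ => (hi i).const_mul _
    · simp only [dotProduct]
      rw [integral_finsetSum _ fun i _ => (hi i).const_mul _]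
      simp [integral_const_mul, hF0]
  have h2 : ∀ n, bform P (y + n) (y + n) + c =
      ((bform P y y + c) + (Pᵀ *ᵥ y + P *ᵥ y) ⬝ᵥ n) + bform P n n := fun n => by
    have e1 : bform P y n = (Pᵀ *ᵥ y) ⬝ᵥ n := by
      rw [bform, Matrix.dotProduct_mulVec, Matrix.mulVec_transpose]
    have e2 : bform P n y = (P *ᵥ y) ⬝ᵥ n := by rw [bform, dotProduct_comm]
    rw [bform_add_left, bform_add_right, bform_add_right, e1, e2, add_dotProduct]
    ring
  simp only [h2]
  have i1 := (integrable_const (μ := F) (bform P y y + c)).add (h1 (Pᵀ *ᵥ y + P *ᵥ y)).1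
  refine ⟨i1.add (integrable_bform_self hF2 P), ?_⟩
  have s1 := integral_add i1 (integrable_bform_self hF2 P)
  have s2 := integral_add (integrable_const (μ := F) (bform P y y + c))
    (h1 (Pᵀ *ᵥ y + P *ᵥ y)).1
  simp only [Pi.add_apply] at s1
  rw [s1, s2, (h1 _).2, integral_const]
  simp [noiseCost]
  ring

theorem lintegral_bform_add [IsProbabilityMeasure F]
    (hF2 : ∀ i, MemLp (fun n : Fin d → ℝ => n i) 2 F)
    (hF0 : ∀ i, ∫ n, n i ∂F = 0) {P : Matrix (Fin d) (Fin d) ℝ} (hP : ∀ x, 0 ≤ bform P x x)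
    (y : Fin d → ℝ) {c : ℝ} (hc : 0 ≤ c) :
    ∫⁻ n, ENNReal.ofReal (bform P (y + n) (y + n) + c) ∂F =
      ENNReal.ofReal (bform P y y + noiseCost F P + c) := by
  obtain ⟨h1, h2⟩ := integral_bform_add hF2 hF0 P y c
  rw [← h2, ofReal_integral_eq_lintegral_ofReal h1]
  exact ae_of_all _ fun n => add_nonneg (hP _) hc

theorem stageCost_add_value [IsProbabilityMeasure F]
    (hF2 : ∀ i, MemLp (fun n : Fin d → ℝ => n i) 2 F)
    (hF0 : ∀ i, ∫ n, n i ∂F = 0) {P Q : Matrix (Fin d) (Fin d) ℝ} (hP : ∀ x, 0 ≤ bform P x x)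
    (hQ : ∀ x, 0 ≤ bform Q x x) {γ r c : ℝ} (hγ : 0 ≤ γ) (hr : 0 ≤ r) (hc : 0 ≤ c)
    (A : Matrix (Fin d) (Fin d) ℝ) (b y : Fin d → ℝ) (u : ℝ) :
    stageCost Q r (y, u) + ENNReal.ofReal γ *
      ∫⁻ w, ENNReal.ofReal (bform P (A *ᵥ y + u • b + w) (A *ᵥ y + u • b + w) + c) ∂F =
    ENNReal.ofReal (bform Q y y + r * u ^ 2 + γ * bform P (A *ᵥ y + u • b) (A *ᵥ y + u • b) +
      γ * (c + noiseCost F P)) := by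
  rw [lintegral_bform_add hF2 hF0 hP _ hc, stageCost, ← ENNReal.ofReal_mul hγ,
    ← ENNReal.ofReal_add]
  · congr 1
    ring
  · exact add_nonneg (hQ y) (mul_nonneg hr (sq_nonneg u))
  · exact mul_nonneg hγ (add_nonneg (add_nonneg (hP _) (noiseCost_nonneg hP)) hc)

end Noise

/-- The contribution of the disturbances to the value of the finite-horizon problems, whose
quadratic parts are given by the matrices `R n`. -/
def noiseIter (F : Measure (Fin d → ℝ)) (γ : ℝ) (R : ℕ → Matrix (Fin d) (Fin d) ℝ) : ℕ → ℝ
  | 0 => 0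
  | n + 1 => γ * (noiseIter F γ R n + noiseCost F (R n))

theorem noiseIter_nonneg {F : Measure (Fin d → ℝ)} {γ : ℝ} (hγ : 0 ≤ γ)
    {R : ℕ → Matrix (Fin d) (Fin d) ℝ} (hR : ∀ n x, 0 ≤ bform (R n) x x) (n : ℕ) :
    0 ≤ noiseIter F γ R n := by
  induction n with
  | zero => exact le_rfl
  | succ n ih => exact mul_nonneg hγ (add_nonneg ih (noiseCost_nonneg (hR n)))

theorem noiseIter_mono {F : Measure (Fin d → ℝ)}
    (hF2 : ∀ i, MemLp (fun n : Fin d → ℝ => n i) 2 F) {γ : ℝ} (hγ : 0 ≤ γ)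
    {R : ℕ → Matrix (Fin d) (Fin d) ℝ} (hR : ∀ n x, 0 ≤ bform (R n) x x)
    (hmono : ∀ x, Monotone fun n => bform (R n) x x) : Monotone (noiseIter F γ R) := by
  refine monotone_nat_of_le_succ fun n => ?_
  induction n with
  | zero => exact noiseIter_nonneg hγ hR 1
  | succ n ih =>
    exact mul_le_mul_of_nonneg_left
      (add_le_add ih (noiseCost_mono hF2 fun x => hmono x n.le_succ)) hγ

/-- The sequence is monotone and bounded, so its limit `c` exists and satisfies `c = γ * (c +
noiseCost F P)`. -/
theorem tendsto_noiseIter {F : Measure (Fin d → ℝ)}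
    (hF2 : ∀ i, MemLp (fun n : Fin d → ℝ => n i) 2 F) {γ : ℝ} (hγ : 0 ≤ γ) (hγ1 : γ < 1)
    {R : ℕ → Matrix (Fin d) (Fin d) ℝ} {P : Matrix (Fin d) (Fin d) ℝ}
    (hR : ∀ n x, 0 ≤ bform (R n) x x)
    (hmono : ∀ x, Monotone fun n => bform (R n) x x) (hlim : Tendsto R atTop (𝓝 P)) :
    Tendsto (noiseIter F γ R) atTop (𝓝 (γ / (1 - γ) * noiseCost F P)) := by
  have h1 : 0 < 1 - γ := by linarith
  have hP : ∀ n x, bform (R n) x x ≤ bform P x x := fun n x =>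
    (hmono x).ge_of_tendsto (((continuous_bform x x).tendsto P).comp hlim) n
  have hb : ∀ n, noiseIter F γ R n ≤ γ / (1 - γ) * noiseCost F P := fun n => by
    induction n with
    | zero =>
      exact mul_nonneg (div_nonneg hγ h1.le)
        (noiseCost_nonneg fun x => (hR 0 x).trans (hP 0 x))
    | succ n ih =>
      calc γ * (noiseIter F γ R n + noiseCost F (R n))
          ≤ γ * (γ / (1 - γ) * noiseCost F P + noiseCost F P) :=
            mul_le_mul_of_nonneg_left (add_le_add ih (noiseCost_mono hF2 (hP n))) hγ
        _ = _ := by field_simp; ring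
  have h2 := tendsto_atTop_ciSup (noiseIter_mono (F := F) hF2 hγ hR hmono)
    ⟨_, by rintro _ ⟨n, rfl⟩; exact hb n⟩
  set c := ⨆ n, noiseIter F γ R n
  have h3 : Tendsto (fun n => noiseIter F γ R (n + 1)) atTop (𝓝 (γ * (c + noiseCost F P))) :=
    (h2.add (((continuous_noiseCost hF2).tendsto P).comp hlim)).const_mul γ
  have h4 := tendsto_nhds_unique h3 ((tendsto_add_atTop_iff_nat 1).2 h2)
  convert h2 using 2
  field_simp
  linarith

/-! ### The limit of infinite control weight. -/

section LargeWeight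

variable {A : Matrix (Fin d) (Fin d) ℝ} {b : Fin d → ℝ} {F : Measure (Fin d → ℝ)}
  {Q : Matrix (Fin d) (Fin d) ℝ} {γ : ℝ}

/-- The gain is of order `1 / r`, so not only the feedback but also its penalty, `r` times the
square of the gain, disappears in the limit. -/
theorem tendsto_riccatiIter_freeIter (n : ℕ) :
    Tendsto (fun r => riccatiIter A b Q γ r n) atTop (𝓝 (freeIter A b Q γ n)) := by
  induction n with
  | zero => exact tendsto_const_nhds
  | succ n ih =>
    have hk : Tendsto (fun r => bform (riccatiIter A b Q γ r n) b b) atTop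
        (𝓝 (bform (freeIter A b Q γ n) b b)) := ((continuous_bform b b).tendsto _).comp ih
    have hw : Tendsto (fun r => r + γ * bform (riccatiIter A b Q γ r n) b b) atTop atTop :=
      tendsto_id.atTop_add (hk.const_mul γ)
    have hv : Tendsto (fun r => b ᵥ* (riccatiIter A b Q γ r n * A)) atTop
        (𝓝 (b ᵥ* (freeIter A b Q γ n * A))) := by
      have c1 : Continuous fun R : Matrix (Fin d) (Fin d) ℝ => b ᵥ* (R * A) :=
        continuous_const.matrix_vecMul (continuous_id.matrix_mul continuous_const)
      exact (c1.tendsto _).comp ih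
    have hs : Tendsto (fun r => γ / (r + γ * bform (riccatiIter A b Q γ r n) b b)) atTop (𝓝 0) :=
      hw.const_div_atTop γ
    have hg : Tendsto (fun r => gain A b γ r (riccatiIter A b Q γ r n)) atTop (𝓝 0) := by
      have := (hs.smul hv).neg
      rw [zero_smul, neg_zero] at this
      exact this
    have hsr : Tendsto (fun r => r * (γ / (r + γ * bform (riccatiIter A b Q γ r n) b b))) atTop
        (𝓝 γ) := by
      have h0 : Tendsto (fun r => γ - γ * bform (riccatiIter A b Q γ r n) b b *
          (γ / (r + γ * bform (riccatiIter A b Q γ r n) b b))) atTop (𝓝 γ) := by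
        simpa using tendsto_const_nhds.sub ((hk.const_mul γ).mul hs)
      refine h0.congr' ?_
      filter_upwards [hw.eventually_gt_atTop 0] with r hr
      field_simp
      ring
    -- The limiting gain is `0`, so the limiting weight is immaterial; `0` matches `freeIter`. What
    -- remains is that the penalty tends to `0`: the product of `r • gain`, which converges, and
    -- `gain`, which vanishes.
    refine tendsto_feedbackStep (r := 0) ?_ hg ih
    have h1 : Tendsto (fun r => r • gain A b γ r (riccatiIter A b Q γ r n)) atTop
        (𝓝 (-(γ • (b ᵥ* (freeIter A b Q γ n * A))))) := by
      refine ((hsr.smul hv).neg).congr fun r => ?_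
      rw [gain, smul_neg, smul_smul]
    have h2 := tendsto_vecMulVec h1 hg
    simp only [Matrix.vecMulVec_zero, Matrix.smul_vecMulVec] at h2
    simpa using h2

theorem tendsto_noiseIter_freeIter (hF2 : ∀ i, MemLp (fun n : Fin d → ℝ => n i) 2 F) (n : ℕ) :
    Tendsto (fun r => noiseIter F γ (riccatiIter A b Q γ r) n) atTop
      (𝓝 (noiseIter F γ (freeIter A b Q γ) n)) := by
  induction n with
  | zero => exact tendsto_const_nhds
  | succ n ih =>
    exact (ih.add (((continuous_noiseCost hF2).tendsto _).comp
      (tendsto_riccatiIter_freeIter n))).const_mul γ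

end LargeWeight

/-! ### The value formula, and monotonicity and concavity in the weight. -/

section Value

variable {A : Matrix (Fin d) (Fin d) ℝ} {b : Fin d → ℝ} {F : Measure (Fin d → ℝ)}
  [IsProbabilityMeasure F] {Q : Matrix (Fin d) (Fin d) ℝ} {γ r : ℝ}

theorem measurable_quadratic (P : Matrix (Fin d) (Fin d) ℝ) (c : ℝ) :
    Measurable fun x : Fin d → ℝ => ENNReal.ofReal (bform P x x + c) :=
  ((continuous_bform_self P).measurable.add_const c).ennreal_ofReal

theorem riccatiIter_le_cost (hF2 : ∀ i, MemLp (fun n : Fin d → ℝ => n i) 2 F)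
    (hF0 : ∀ i, ∫ n, n i ∂F = 0) (hγ : 0 ≤ γ) (hr : 0 < r) (hQ : Q.IsSymm)
    (hQ0 : ∀ x, 0 ≤ bform Q x x) (π : Policy d) (x : Fin d → ℝ) (N : ℕ) :
    ENNReal.ofReal (bform (riccatiIter A b Q γ r N) x x +
      noiseIter F γ (riccatiIter A b Q γ r) N) ≤ cost A b F Q γ r π x := by
  have hR := riccatiIter_nonneg (A := A) (b := b) hγ hr.le hQ0
  refine value_le_cost (V := fun n y => ENNReal.ofReal (bform (riccatiIter A b Q γ r n) y y +
      noiseIter F γ (riccatiIter A b Q γ r) n)) hγ (fun n => measurable_quadratic _ _) ?_ ?_ N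
  · simp [riccatiIter, noiseIter]
  · intro n y u
    rw [stageCost_add_value hF2 hF0 (hR n) hQ0 hγ hr.le (noiseIter_nonneg hγ hR n)]
    refine ENNReal.ofReal_le_ofReal (add_le_add ?_ le_rfl)
    exact riccatiStep_le hγ hr (isSymm_riccatiIter hQ n) (hR n) y u

theorem cost_zeroPolicy_le (hF2 : ∀ i, MemLp (fun n : Fin d → ℝ => n i) 2 F)
    (hF0 : ∀ i, ∫ n, n i ∂F = 0) (hγ : 0 ≤ γ) (hr : 0 ≤ r)
    (hQ0 : ∀ x, 0 ≤ bform Q x x) (x : Fin d → ℝ) {M : ℝ≥0∞}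
    (hM : ∀ N, ENNReal.ofReal (bform (freeIter A b Q γ N) x x +
      noiseIter F γ (freeIter A b Q γ) N) ≤ M) :
    cost A b F Q γ r (zeroPolicy d) x ≤ M := by
  have hR := freeIter_nonneg (A := A) (b := b) hγ hQ0
  refine cost_le_of_value_le (V := fun n y => ENNReal.ofReal (bform (freeIter A b Q γ n) y y +
      noiseIter F γ (freeIter A b Q γ) n)) hγ zeroPolicy_law
      (fun n => measurable_quadratic _ _) ?_ hM
  intro n y
  rw [stageCost_add_value hF2 hF0 (hR n) hQ0 hγ hr (noiseIter_nonneg hγ hR n)]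
  refine ENNReal.ofReal_le_ofReal (add_le_add (le_of_eq ?_) le_rfl)
  simp [freeIter, bform_feedbackStep, closedLoop_mulVec]

/-- The fixed point yields a stationary value function for which the Bellman inequality of the
optimal feedback is an equality; the noise constant solves `c = γ * (c + noiseCost F P)`. -/
theorem optCost_le_riccatiLimit (hF2 : ∀ i, MemLp (fun n : Fin d → ℝ => n i) 2 F)
    (hF0 : ∀ i, ∫ n, n i ∂F = 0) (hγ : 0 ≤ γ) (hγ1 : γ < 1) (hr : 0 < r) (hQ : Q.IsSymm)
    (hQ0 : ∀ x, 0 ≤ bform Q x x) (hctrl : Controllable A b) (x : Fin d → ℝ) :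
    optCost A b F Q γ r x ≤ ENNReal.ofReal (bform (riccatiLimit A b Q γ r) x x +
      γ / (1 - γ) * noiseCost F (riccatiLimit A b Q γ r)) := by
  have hP := riccatiLimit_nonneg hγ hr hQ hQ0 hctrl
  have hfix := riccatiStep_riccatiLimit hγ hr hQ hQ0 hctrl
  have h1 : 0 < 1 - γ := by linarith
  have hc : 0 ≤ γ / (1 - γ) * noiseCost F (riccatiLimit A b Q γ r) :=
    mul_nonneg (div_nonneg hγ h1.le) (noiseCost_nonneg hP)
  refine (iInf_le _ (feedbackPolicy (gain A b γ r (riccatiLimit A b Q γ r)))).trans ?_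
  refine cost_le_of_value_le (V := fun _ y => ENNReal.ofReal (bform (riccatiLimit A b Q γ r) y y +
      γ / (1 - γ) * noiseCost F (riccatiLimit A b Q γ r))) hγ (feedbackPolicy_law _)
      (fun n => measurable_quadratic _ _) ?_ fun _ => le_rfl
  intro n y
  rw [stageCost_add_value hF2 hF0 hP hQ0 hγ hr.le hc, ← bform_riccatiStep_self, hfix]
  refine ENNReal.ofReal_le_ofReal (add_le_add le_rfl (le_of_eq ?_))
  field_simp
  ring

theorem optCost_eq (hF2 : ∀ i, MemLp (fun n : Fin d → ℝ => n i) 2 F)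
    (hF0 : ∀ i, ∫ n, n i ∂F = 0) (hγ : 0 ≤ γ) (hγ1 : γ < 1) (hr : 0 < r) (hQ : Q.IsSymm)
    (hQ0 : ∀ x, 0 ≤ bform Q x x) (hctrl : Controllable A b) (x : Fin d → ℝ) :
    optCost A b F Q γ r x = ENNReal.ofReal (bform (riccatiLimit A b Q γ r) x x +
      γ / (1 - γ) * noiseCost F (riccatiLimit A b Q γ r)) := by
  refine le_antisymm (optCost_le_riccatiLimit hF2 hF0 hγ hγ1 hr hQ hQ0 hctrl x) ?_
  have h1 := tendsto_noiseIter (F := F) hF2 hγ hγ1 (riccatiIter_nonneg hγ hr.le hQ0)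
    (riccatiIter_mono hγ hr hQ hQ0) (tendsto_riccatiIter hγ hr hQ hQ0 hctrl)
  have h2 := (tendsto_bform_riccatiIter hγ hr hQ hQ0 hctrl x x).add h1
  refine le_of_tendsto' (ENNReal.tendsto_ofReal h2) fun N => ?_
  exact le_iInf fun π => riccatiIter_le_cost hF2 hF0 hγ hr hQ hQ0 π x N

theorem J_eq (hF2 : ∀ i, MemLp (fun n : Fin d → ℝ => n i) 2 F)
    (hF0 : ∀ i, ∫ n, n i ∂F = 0) (hγ : 0 ≤ γ) (hγ1 : γ < 1) (hr : 0 < r) (hQ : Q.IsSymm)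
    (hQ0 : ∀ x, 0 ≤ bform Q x x) (hctrl : Controllable A b) (x : Fin d → ℝ) :
    J A b F Q γ r x = bform (riccatiLimit A b Q γ r) x x +
      γ / (1 - γ) * noiseCost F (riccatiLimit A b Q γ r) := by
  have hP := riccatiLimit_nonneg hγ hr hQ hQ0 hctrl
  rw [J, optCost_eq hF2 hF0 hγ hγ1 hr hQ hQ0 hctrl, ENNReal.toReal_ofReal]
  exact add_nonneg (hP x) (mul_nonneg (div_nonneg hγ (by linarith)) (noiseCost_nonneg hP))

/-- If the optimal cost is eventually at most `M`, then so is the cost of exerting no control. -/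
theorem cost_zeroPolicy_le_of_forall_optCost_le
    (hF2 : ∀ i, MemLp (fun n : Fin d → ℝ => n i) 2 F)
    (hF0 : ∀ i, ∫ n, n i ∂F = 0) (hγ : 0 ≤ γ) (hr : 0 < r) (hQ : Q.IsSymm)
    (hQ0 : ∀ x, 0 ≤ bform Q x x) (x : Fin d → ℝ) {M : ℝ≥0∞}
    (hM : ∀ᶠ s in atTop, optCost A b F Q γ s x ≤ M) :
    cost A b F Q γ r (zeroPolicy d) x ≤ M := by
  refine cost_zeroPolicy_le hF2 hF0 hγ hr.le hQ0 x fun N => ?_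
  have h1 : Tendsto (fun r => bform (riccatiIter A b Q γ r N) x x) atTop
      (𝓝 (bform (freeIter A b Q γ N) x x)) :=
    ((continuous_bform x x).tendsto _).comp (tendsto_riccatiIter_freeIter N)
  -- The horizon `N` stays fixed while the weight tends to infinity; no exchange of the two limits
  -- is required.
  refine le_of_tendsto (ENNReal.tendsto_ofReal (h1.add (tendsto_noiseIter_freeIter hF2 N))) ?_
  filter_upwards [hM, eventually_gt_atTop 0] with s hs hs0
  exact (le_iInf fun π => riccatiIter_le_cost hF2 hF0 hγ hs0 hQ hQ0 π x N).trans hs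

theorem cost_zeroPolicy_congr (s : ℝ) (x : Fin d → ℝ) (hγ : 0 ≤ γ) :
    cost A b F Q γ r (zeroPolicy d) x = cost A b F Q γ s (zeroPolicy d) x := by
  rw [cost_eq_tsum _ _ _ _ _ _ _ _ hγ, cost_eq_tsum _ _ _ _ _ _ _ _ hγ]
  refine tsum_congr fun t => ?_
  rw [lintegral_pathMeasure_feedback A b F x zeroPolicy_law t (measurable_stageCost Q r),
    lintegral_pathMeasure_feedback A b F x zeroPolicy_law t (measurable_stageCost Q s)]
  simp [stageCost]

theorem cost_mono {s : ℝ} (hγ : 0 ≤ γ) (hrs : r ≤ s) (π : Policy d) (x : Fin d → ℝ) :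
    cost A b F Q γ r π x ≤ cost A b F Q γ s π x := by
  refine lintegral_mono fun ω => ENNReal.tsum_le_tsum fun t => ?_
  refine ENNReal.ofReal_le_ofReal ?_
  gcongr

theorem optCost_mono {s : ℝ} (hγ : 0 ≤ γ) (hrs : r ≤ s) (x : Fin d → ℝ) :
    optCost A b F Q γ r x ≤ optCost A b F Q γ s x :=
  iInf_mono fun π => cost_mono hγ hrs π x

/-- The cost of a fixed policy is affine in the weight. Only this inequality is needed, and for it
the integral estimates ask for no measurability. -/
theorem cost_concave (hγ : 0 ≤ γ) (hQ0 : ∀ x, 0 ≤ bform Q x x) {s α β : ℝ} (hr : 0 ≤ r)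
    (hs : 0 ≤ s) (hα : 0 ≤ α) (hβ : 0 ≤ β) (hαβ : α + β = 1) (π : Policy d) (x : Fin d → ℝ) :
    ENNReal.ofReal α * cost A b F Q γ r π x + ENNReal.ofReal β * cost A b F Q γ s π x ≤
      cost A b F Q γ (α * r + β * s) π x := by
  unfold cost
  refine (add_le_add (lintegral_const_mul_le _ _) (lintegral_const_mul_le _ _)).trans ?_
  refine (le_lintegral_add _ _).trans (lintegral_mono fun ω => le_of_eq ?_)
  simp only [← ENNReal.tsum_mul_left]
  rw [← ENNReal.tsum_add]
  refine tsum_congr fun t => ?_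
  have hq : 0 ≤ (ω t).1 ⬝ᵥ (Q *ᵥ (ω t).1) := hQ0 _
  rw [← ENNReal.ofReal_mul hα, ← ENNReal.ofReal_mul hβ, ← ENNReal.ofReal_add (by positivity)
    (by positivity)]
  congr 1
  linear_combination (γ ^ t * ((ω t).1 ⬝ᵥ (Q *ᵥ (ω t).1))) * hαβ

theorem concaveOn_J (hfin : ∀ (x : Fin d → ℝ) (r : ℝ), 0 < r → optCost A b F Q γ r x ≠ ∞)
    (hγ : 0 ≤ γ) (hQ0 : ∀ x, 0 ≤ bform Q x x) (x : Fin d → ℝ) :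
    ConcaveOn ℝ (Ioi 0) (fun r => J A b F Q γ r x) := by
  refine ⟨convex_Ioi 0, fun r hr s hs α β hα hβ hαβ => ?_⟩
  simp only [mem_Ioi, smul_eq_mul] at *
  have hp : 0 < α * r + β * s := by
    rcases hα.eq_or_lt with rfl | h
    · have : β = 1 := by linarith
      subst this
      linarith
    · have := mul_pos h hr
      have := mul_nonneg hβ hs.le
      linarith
  have h : ENNReal.ofReal α * optCost A b F Q γ r x + ENNReal.ofReal β * optCost A b F Q γ s x ≤
      optCost A b F Q γ (α * r + β * s) x := by
    refine le_iInf fun π => le_trans ?_ (cost_concave hγ hQ0 hr.le hs.le hα hβ hαβ π x)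
    gcongr
    · exact iInf_le _ π
    · exact iInf_le _ π
  have h' := ENNReal.toReal_mono (hfin x _ hp) h
  rw [ENNReal.toReal_add (ENNReal.mul_ne_top ENNReal.ofReal_ne_top (hfin x r hr))
    (ENNReal.mul_ne_top ENNReal.ofReal_ne_top (hfin x s hs)), ENNReal.toReal_mul,
    ENNReal.toReal_mul, ENNReal.toReal_ofReal hα, ENNReal.toReal_ofReal hβ] at h'
  exact h'

end Value

theorem tendsto_zero_of_sq {ι : Type*} {l : Filter ι} {f : ι → ℝ}
    (h : Tendsto (fun i => f i ^ 2) l (𝓝 0)) : Tendsto f l (𝓝 0) := by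
  rw [tendsto_zero_iff_abs_tendsto_zero]
  have := h.sqrt
  rw [Real.sqrt_zero] at this
  exact this.congr fun i => Real.sqrt_sq_eq_abs (f i)

/-! ### Stability of the optimal closed loop. -/

section Stability

variable {A : Matrix (Fin d) (Fin d) ℝ} {b : Fin d → ℝ} {Q : Matrix (Fin d) (Fin d) ℝ}
  {γ r : ℝ}

theorem ObservableCost.exists_factor (h : ObservableCost A Q) :
    ∃ C : Matrix (Fin d) (Fin d) ℝ, (∀ x, bform Q x x = (C *ᵥ x) ⬝ᵥ (C *ᵥ x)) ∧
      Observable A C := by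
  obtain ⟨M, -, lam, hlam, rfl, hobs⟩ := h
  refine ⟨_, fun x => ?_, hobs⟩
  rw [bform_conj, bform, ← Matrix.mulVec_mulVec]
  simp only [dotProduct, Matrix.mulVec_diagonal]
  refine Finset.sum_congr rfl fun i _ => ?_
  have := Real.mul_self_sqrt (hlam i)
  linear_combination -((M *ᵥ x) i * (M *ᵥ x) i) * this

/-- Observability makes the stacked observation map injective, so it has a linear left inverse,
continuous by finite dimension. -/
theorem tendsto_zero_of_observable {C : Matrix (Fin d) (Fin d) ℝ} (hobs : Observable A C)
    {z : ℕ → Fin d → ℝ} (hz : ∀ k : ℕ, Tendsto (fun t => (C * A ^ k) *ᵥ z t) atTop (𝓝 0)) :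
    Tendsto z atTop (𝓝 0) := by
  let Φ : (Fin d → ℝ) →ₗ[ℝ] (Fin d → Fin d → ℝ) :=
    LinearMap.pi fun k => (C * A ^ (k : ℕ)).mulVecLin
  have hΦ : LinearMap.ker Φ = ⊥ := by
    refine LinearMap.ker_eq_bot'.2 fun y hy => hobs y fun k => ?_
    exact congrFun hy k
  obtain ⟨G, hG⟩ := LinearMap.exists_leftInverse_of_injective Φ hΦ
  have h1 : Tendsto (fun t => Φ (z t)) atTop (𝓝 0) := tendsto_pi_nhds.2 fun k => hz k
  have h2 := ((LinearMap.continuous_of_finiteDimensional G).tendsto 0).comp h1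
  rw [map_zero] at h2
  refine h2.congr fun t => ?_
  exact LinearMap.congr_fun hG (z t)

theorem bform_riccatiLimit_self (hγ : 0 ≤ γ) (hr : 0 < r) (hQ : Q.IsSymm)
    (hQ0 : ∀ x, 0 ≤ bform Q x x) (hctrl : Controllable A b) (x : Fin d → ℝ) :
    bform (riccatiLimit A b Q γ r) x x = bform Q x x +
      γ * bform (riccatiLimit A b Q γ r)
        (closedLoop A b (gain A b γ r (riccatiLimit A b Q γ r)) *ᵥ x)
        (closedLoop A b (gain A b γ r (riccatiLimit A b Q γ r)) *ᵥ x) +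
      r * (gain A b γ r (riccatiLimit A b Q γ r) ⬝ᵥ x) ^ 2 := by
  conv_lhs => rw [← riccatiStep_riccatiLimit hγ hr hQ hQ0 hctrl, riccatiStep, bform_feedbackStep]
  rw [sq]

/-- `xᵀ P x` is a Lyapunov function: along the orbit it decreases by the stage cost and stays
nonnegative, so the stage cost tends to `0`. Hence both the observation and the control tend to `0`,
and observability recovers the state. The factor `√γ` absorbs the discount. -/
theorem closedLoop_stable (hγ : 0 < γ) (hr : 0 < r) (hQ : Q.IsSymm)
    (hQ0 : ∀ x, 0 ≤ bform Q x x) (hctrl : Controllable A b) (hobs : ObservableCost A Q)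
    (x : Fin d → ℝ) :
    Tendsto (fun t : ℕ => ((√γ • closedLoop A b (gain A b γ r (riccatiLimit A b Q γ r))) ^ t) *ᵥ x)
      atTop (𝓝 0) := by
  obtain ⟨C, hC, hobs⟩ := hobs.exists_factor
  have hen := bform_riccatiLimit_self hγ.le hr hQ hQ0 hctrl
  have hP := riccatiLimit_nonneg hγ.le hr hQ hQ0 hctrl
  set P := riccatiLimit A b Q γ r
  set K := gain A b γ r P
  set z : ℕ → Fin d → ℝ := fun t => ((√γ • closedLoop A b K) ^ t) *ᵥ x with hz
  have hsq : √γ * √γ = γ := Real.mul_self_sqrt hγ.le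
  have hsq0 : √γ ≠ 0 := (Real.sqrt_pos.2 hγ).ne'
  have hstep : ∀ t, z (t + 1) = √γ • (A *ᵥ z t + (K ⬝ᵥ z t) • b) := fun t => by
    simp only [hz]
    rw [pow_succ', ← Matrix.mulVec_mulVec, Matrix.smul_mulVec, closedLoop_mulVec]
  have hdec : ∀ t, bform P (z t) (z t) - bform P (z (t + 1)) (z (t + 1)) =
      bform Q (z t) (z t) + r * (K ⬝ᵥ z t) ^ 2 := fun t => by
    rw [hstep, bform_smul_left, bform_smul_right, ← closedLoop_mulVec, hen (z t), ← mul_assoc, hsq]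
    ring
  have hanti : Antitone fun t => bform P (z t) (z t) := antitone_nat_of_succ_le fun t => by
    have := hQ0 (z t)
    have := mul_nonneg hr.le (sq_nonneg (K ⬝ᵥ z t))
    linarith [hdec t]
  have hlim := tendsto_atTop_ciInf hanti ⟨0, by rintro _ ⟨t, rfl⟩; exact hP _⟩
  have he : Tendsto (fun t => bform Q (z t) (z t) + r * (K ⬝ᵥ z t) ^ 2) atTop (𝓝 0) := by
    have := hlim.sub ((tendsto_add_atTop_iff_nat 1).2 hlim)
    rw [sub_self] at this
    exact this.congr hdec
  have hQz : Tendsto (fun t => bform Q (z t) (z t)) atTop (𝓝 0) :=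
    squeeze_zero (fun t => hQ0 _)
      (fun t => le_add_of_nonneg_right (mul_nonneg hr.le (sq_nonneg _))) he
  have hKz : Tendsto (fun t => K ⬝ᵥ z t) atTop (𝓝 0) := by
    have h1 : Tendsto (fun t => r * (K ⬝ᵥ z t) ^ 2) atTop (𝓝 0) :=
      squeeze_zero (fun t => mul_nonneg hr.le (sq_nonneg _))
        (fun t => le_add_of_nonneg_left (hQ0 _)) he
    have h2 := h1.const_mul r⁻¹
    simp only [mul_zero, inv_mul_cancel_left₀ hr.ne'] at h2
    exact tendsto_zero_of_sq h2
  refine tendsto_zero_of_observable hobs fun k => ?_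
  induction k with
  | zero =>
    simp only [pow_zero, mul_one]
    refine tendsto_pi_nhds.2 fun i => ?_
    have h1 : Tendsto (fun t => (C *ᵥ z t) i ^ 2) atTop (𝓝 0) := by
      refine squeeze_zero (fun t => sq_nonneg _) (fun t => ?_) hQz
      rw [hC, dotProduct, sq]
      exact Finset.single_le_sum (f := fun i => (C *ᵥ z t) i * (C *ᵥ z t) i)
        (fun i _ => mul_self_nonneg _) (Finset.mem_univ i)
    exact tendsto_zero_of_sq h1
  | succ k ih =>
    -- The observation `C A ^ (k + 1)` of `z t` is that of `C A ^ k` one step later, up to rescaling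
    -- and a control term that vanishes.
    have h1 : Tendsto (fun t => (√γ)⁻¹ • (C * A ^ k) *ᵥ z (t + 1) -
        (K ⬝ᵥ z t) • (C * A ^ k) *ᵥ b) atTop (𝓝 0) := by
      have := (((tendsto_add_atTop_iff_nat 1).2 ih).const_smul (√γ)⁻¹).sub
        (hKz.smul_const ((C * A ^ k) *ᵥ b))
      simpa using this
    refine h1.congr fun t => ?_
    rw [hstep, Matrix.mulVec_smul, inv_smul_smul₀ hsq0, Matrix.mulVec_add, Matrix.mulVec_smul,
      add_sub_cancel_right, Matrix.mulVec_mulVec, Matrix.mul_assoc, ← pow_succ]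

theorem tendsto_bform {ι : Type*} {l : Filter ι} (X : Matrix (Fin d) (Fin d) ℝ)
    {f g : ι → Fin d → ℝ} {x y : Fin d → ℝ} (hf : Tendsto f l (𝓝 x)) (hg : Tendsto g l (𝓝 y)) :
    Tendsto (fun i => bform X (f i) (g i)) l (𝓝 (bform X x y)) := by
  simp only [bform_eq_sum]
  exact tendsto_finsetSum _ fun i _ => tendsto_finsetSum _ fun j _ =>
    ((tendsto_pi_nhds.1 hf i).mul (tendsto_pi_nhds.1 hg j)).const_mul _

/-- The equation says that the form `X` is invariant under `√γ • M`, whose powers send both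
arguments to `0`. -/
theorem eq_zero_of_stein {M X : Matrix (Fin d) (Fin d) ℝ} (hγ : 0 ≤ γ)
    (hM : ∀ x, Tendsto (fun t : ℕ => ((√γ • M) ^ t) *ᵥ x) atTop (𝓝 0))
    (hX : X - γ • (Mᵀ * X * M) = 0) : X = 0 := by
  refine ext_bform fun x y => ?_
  have h1 : ∀ x y, bform X ((√γ • M) *ᵥ x) ((√γ • M) *ᵥ y) = bform X x y := fun x y => by
    conv_rhs => rw [sub_eq_zero.1 hX, bform_smul, bform_conj, ← Real.mul_self_sqrt hγ]
    rw [Matrix.smul_mulVec, Matrix.smul_mulVec, bform_smul_left, bform_smul_right, mul_assoc]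
  have h2 : ∀ (t : ℕ) x y, bform X (((√γ • M) ^ t) *ᵥ x) (((√γ • M) ^ t) *ᵥ y) = bform X x y := by
    intro t
    induction t with
    | zero => simp
    | succ t ih =>
      intro x y
      rw [pow_succ, ← Matrix.mulVec_mulVec, ← Matrix.mulVec_mulVec, ih, h1]
  have h3 : Tendsto (fun t : ℕ => bform X (((√γ • M) ^ t) *ᵥ x) (((√γ • M) ^ t) *ᵥ y)) atTop
      (𝓝 (bform X 0 0)) := tendsto_bform X (hM x) (hM y)
  simp only [h2, bform_zero_left] at h3
  rw [bform_zero]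
  exact tendsto_nhds_unique tendsto_const_nhds h3

end Stability

/-! ### Stein operators: inversion and differentiation. -/

section Stein

variable {E : Type*} [NormedRing E] [NormedAlgebra ℝ E]

/-- The Stein operator `X ↦ X - γ L X R`. -/
def stein (γ : ℝ) (L R : E) : E →L[ℝ] E :=
  ContinuousLinearMap.id ℝ _ - γ • ContinuousLinearMap.mulLeftRight ℝ E L R

/-- The solution `X` of the Stein equation `X - γ L X R = V`, if it is unique. -/
def steinSolve (γ : ℝ) (L R V : E) : E := (stein γ L R).inverse V

theorem ContDiffWithinAt.stein {L R : ℝ → E} {s : Set ℝ} {r : ℝ} {n : WithTop ℕ∞}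
    (hL : ContDiffWithinAt ℝ n L s r) (hR : ContDiffWithinAt ℝ n R s r) (γ : ℝ) :
    ContDiffWithinAt ℝ n (fun t => stein γ (L t) (R t)) s r := by
  unfold LQR.stein
  fun_prop

theorem continuousAt_stein {R : ℝ → E} {r : ℝ} (hR : ContinuousAt R r) (γ : ℝ) (L : E) :
    ContinuousAt (fun t => stein γ L (R t)) r := by
  unfold stein
  fun_prop

variable [FiniteDimensional ℝ E]

theorem isInvertible_stein {γ : ℝ} {L R : E} (h : ∀ X : E, X - γ • (L * X * R) = 0 → X = 0) :
    (stein γ L R).IsInvertible := by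
  have hinj : Function.Injective (stein γ L R : E →ₗ[ℝ] E) := (injective_iff_map_eq_zero _).2 h
  exact ⟨(LinearEquiv.ofInjectiveEndo _ hinj).toContinuousLinearEquiv, by ext1 X; rfl⟩

theorem ContDiffWithinAt.steinSolve {γ : ℝ} {L R V : ℝ → E} {s : Set ℝ} {r : ℝ}
    {n : WithTop ℕ∞} (hL : ContDiffWithinAt ℝ n L s r) (hR : ContDiffWithinAt ℝ n R s r)
    (hV : ContDiffWithinAt ℝ n V s r) (h : ∀ X : E, X - γ • (L r * X * R r) = 0 → X = 0) :
    ContDiffWithinAt ℝ n (fun t => steinSolve γ (L t) (R t) (V t)) s r := by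
  have : CompleteSpace E := FiniteDimensional.complete ℝ E
  have h1 : ContDiffWithinAt ℝ n (fun t => LQR.stein γ (L t) (R t)) s r :=
    ContDiffWithinAt.stein hL hR γ
  have h2 : ContDiffAt ℝ n ContinuousLinearMap.inverse (LQR.stein γ (L r) (R r)) :=
    (isInvertible_stein h).contDiffAt_map_inverse
  have h3 : ContDiffWithinAt ℝ n (fun t => (LQR.stein γ (L t) (R t)).inverse) s r :=
    ContDiffAt.comp_contDiffWithinAt (g := ContinuousLinearMap.inverse)
      (f := fun t => LQR.stein γ (L t) (R t)) r h2 h1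
  exact h3.clm_apply hV

theorem steinSolve_spec {γ : ℝ} {L R : E} (h : ∀ X : E, X - γ • (L * X * R) = 0 → X = 0)
    (V : E) : steinSolve γ L R V - γ • (L * steinSolve γ L R V * R) = V := by
  obtain ⟨e, he⟩ := isInvertible_stein h
  have h1 : stein γ L R (steinSolve γ L R V) = V := by
    rw [steinSolve, ← he, ContinuousLinearMap.inverse_equiv]
    exact e.apply_symm_apply V
  exact h1

/-- The difference quotient of `P` is exactly the inverse Stein operator at `s` applied to `V s`.
Inversion is continuous at an invertible operator, so continuity of `R` and `V` suffices. -/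
theorem hasDerivAt_of_stein {γ r : ℝ} {P R V : ℝ → E} {L : E} (hR : ContinuousAt R r)
    (hV : ContinuousAt V r) (h : ∀ X : E, X - γ • (L * X * R r) = 0 → X = 0)
    (hP : ∀ᶠ s in 𝓝 r, (P s - P r) - γ • (L * (P s - P r) * R s) = (s - r) • V s) :
    HasDerivAt P (steinSolve γ L (R r) (V r)) r := by
  have : CompleteSpace E := FiniteDimensional.complete ℝ E
  have hinv := isInvertible_stein h
  have hS : ContinuousAt (fun s => stein γ L (R s)) r := continuousAt_stein hR γ L
  have hev : ∀ᶠ s in 𝓝 r, (stein γ L (R s)).IsInvertible := by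
    obtain ⟨e, he⟩ := hinv
    have hn := e.nhds
    rw [he] at hn
    exact hS.eventually hn
  have hI : ContinuousAt (fun s => (stein γ L (R s)).inverse) r :=
    ContinuousAt.comp (g := ContinuousLinearMap.inverse) (f := fun s => stein γ L (R s))
      (hinv.contDiffAt_map_inverse (n := 0)).continuousAt hS
  have hlim : ContinuousAt (fun s => (stein γ L (R s)).inverse (V s)) r := hI.clm_apply hV
  rw [hasDerivAt_iff_tendsto_slope]
  refine (hlim.tendsto.mono_left nhdsWithin_le_nhds).congr' ?_
  filter_upwards [nhdsWithin_le_nhds hev, nhdsWithin_le_nhds hP, self_mem_nhdsWithin]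
    with s hs hPs hne
  obtain ⟨f, hf⟩ := hs
  have hsr : s - r ≠ 0 := sub_ne_zero.2 hne
  have h1 : f (P s - P r) = (s - r) • V s := by
    rw [← ContinuousLinearEquiv.coe_coe, hf]
    exact hPs
  rw [← hf, ContinuousLinearMap.inverse_equiv, slope_def_module,
    ContinuousLinearEquiv.coe_coe, ContinuousLinearEquiv.symm_apply_eq, map_smul, h1,
    inv_smul_smul₀ hsr]

end Stein

/-! ### Smooth dependence of the Riccati solution on the weight. -/

section Smooth

open scoped Matrix.Norms.Operator

variable {A : Matrix (Fin d) (Fin d) ℝ} {b : Fin d → ℝ} {Q : Matrix (Fin d) (Fin d) ℝ}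
  {γ r : ℝ}

/-- The gain of the optimal feedback. -/
def optGain (A : Matrix (Fin d) (Fin d) ℝ) (b : Fin d → ℝ) (Q : Matrix (Fin d) (Fin d) ℝ)
    (γ r : ℝ) : Fin d → ℝ := gain A b γ r (riccatiLimit A b Q γ r)

/-- The solution of the Stein equation that determines the derivative of `riccatiLimit` with
respect to the weight. -/
def riccatiDeriv (A : Matrix (Fin d) (Fin d) ℝ) (b : Fin d → ℝ) (Q : Matrix (Fin d) (Fin d) ℝ)
    (γ r : ℝ) : Matrix (Fin d) (Fin d) ℝ :=
  steinSolve γ (closedLoop A b (optGain A b Q γ r))ᵀ (closedLoop A b (optGain A b Q γ r))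
    (Matrix.vecMulVec (optGain A b Q γ r) (optGain A b Q γ r))

theorem stein_riccati_injective (hγ : 0 < γ) (hr : 0 < r) (hQ : Q.IsSymm)
    (hQ0 : ∀ x, 0 ≤ bform Q x x) (hctrl : Controllable A b) (hobs : ObservableCost A Q)
    (X : Matrix (Fin d) (Fin d) ℝ)
    (hX : X - γ • ((closedLoop A b (optGain A b Q γ r))ᵀ * X *
      closedLoop A b (optGain A b Q γ r)) = 0) : X = 0 :=
  eq_zero_of_stein hγ.le (closedLoop_stable hγ hr hQ hQ0 hctrl hobs) hX

theorem riccatiDeriv_spec (hγ : 0 < γ) (hr : 0 < r) (hQ : Q.IsSymm)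
    (hQ0 : ∀ x, 0 ≤ bform Q x x) (hctrl : Controllable A b) (hobs : ObservableCost A Q) :
    riccatiDeriv A b Q γ r - γ • ((closedLoop A b (optGain A b Q γ r))ᵀ *
      riccatiDeriv A b Q γ r * closedLoop A b (optGain A b Q γ r)) =
        Matrix.vecMulVec (optGain A b Q γ r) (optGain A b Q γ r) :=
  steinSolve_spec (stein_riccati_injective hγ hr hQ hQ0 hctrl hobs) _

theorem contDiff_of_linear {V W : Type*} [NormedAddCommGroup V] [NormedSpace ℝ V]
    [FiniteDimensional ℝ V] [NormedAddCommGroup W] [NormedSpace ℝ W] {n : WithTop ℕ∞}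
    {f : V → W} (hf : IsLinearMap ℝ f) : ContDiff ℝ n f :=
  (LinearMap.toContinuousLinearMap hf.mk').contDiff

theorem contDiffOn_vecMulVec {n : WithTop ℕ∞} {s : Set ℝ} {K L : ℝ → Fin d → ℝ}
    (hK : ContDiffOn ℝ n K s) (hL : ContDiffOn ℝ n L s) :
    ContDiffOn ℝ n (fun t => Matrix.vecMulVec (K t) (L t)) s := by
  have hD : ContDiff ℝ n (Matrix.diagonal : (Fin d → ℝ) → Matrix (Fin d) (Fin d) ℝ) :=
    contDiff_of_linear ⟨fun x y => (Matrix.diagonal_add x y).symm,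
      fun c x => Matrix.diagonal_smul c x⟩
  -- Written with diagonal matrices around the all-ones matrix, the outer product is a product in
  -- the normed ring of matrices, each factor depending linearly on its vector.
  have h : ∀ t, Matrix.vecMulVec (K t) (L t) = Matrix.diagonal (K t) *
      Matrix.of (fun _ _ => (1 : ℝ)) * Matrix.diagonal (L t) := fun t => by
    ext i j
    simp [Matrix.vecMulVec_apply, Matrix.mul_diagonal, Matrix.diagonal_mul]
  simp only [h]
  exact ((hD.comp_contDiffOn hK).mul contDiffOn_const).mul (hD.comp_contDiffOn hL)

theorem contDiffOn_optGain (hγ : 0 < γ) (hQ : Q.IsSymm)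
    (hQ0 : ∀ x, 0 ≤ bform Q x x) (hctrl : Controllable A b) {n : WithTop ℕ∞}
    (hP : ContDiffOn ℝ n (riccatiLimit A b Q γ) (Ioi 0)) :
    ContDiffOn ℝ n (optGain A b Q γ) (Ioi 0) := by
  have h1 : ContDiffOn ℝ n (fun r => bform (riccatiLimit A b Q γ r) b b) (Ioi 0) :=
    (contDiff_of_linear (f := fun P : Matrix (Fin d) (Fin d) ℝ => bform P b b)
      ⟨fun _ _ => bform_add _ _ _ _, fun _ _ => bform_smul _ _ _ _⟩).comp_contDiffOn hP
  have h2 : ContDiffOn ℝ n (fun r => b ᵥ* (riccatiLimit A b Q γ r * A)) (Ioi 0) :=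
    (contDiff_of_linear (f := fun P : Matrix (Fin d) (Fin d) ℝ => b ᵥ* (P * A))
      ⟨fun _ _ => by simp [Matrix.add_mul, Matrix.vecMul_add],
        fun _ _ => by simp [Matrix.vecMul_smul]⟩).comp_contDiffOn hP
  have h3 : ContDiffOn ℝ n (fun r => γ / (r + γ * bform (riccatiLimit A b Q γ r) b b)) (Ioi 0) :=
    contDiffOn_const.div (contDiffOn_id.add (contDiffOn_const.mul h1)) fun r hr =>
      (weight_pos hγ.le hr (riccatiLimit_nonneg hγ.le hr hQ hQ0 hctrl)).ne'
  exact (h3.smul h2).neg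

theorem contDiffOn_optClosedLoop (hγ : 0 < γ) (hQ : Q.IsSymm)
    (hQ0 : ∀ x, 0 ≤ bform Q x x) (hctrl : Controllable A b) {n : WithTop ℕ∞}
    (hP : ContDiffOn ℝ n (riccatiLimit A b Q γ) (Ioi 0)) :
    ContDiffOn ℝ n (fun r => closedLoop A b (optGain A b Q γ r)) (Ioi 0) :=
  contDiffOn_const.add
    (contDiffOn_vecMulVec contDiffOn_const (contDiffOn_optGain hγ hQ hQ0 hctrl hP))

theorem contDiff_transpose {n : WithTop ℕ∞} :
    ContDiff ℝ n (Matrix.transpose : Matrix (Fin d) (Fin d) ℝ → Matrix (Fin d) (Fin d) ℝ) :=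
  contDiff_of_linear ⟨Matrix.transpose_add, Matrix.transpose_smul⟩

theorem contDiffOn_riccatiDeriv (hγ : 0 < γ) (hQ : Q.IsSymm)
    (hQ0 : ∀ x, 0 ≤ bform Q x x) (hctrl : Controllable A b) (hobs : ObservableCost A Q)
    {n : WithTop ℕ∞} (hP : ContDiffOn ℝ n (riccatiLimit A b Q γ) (Ioi 0)) :
    ContDiffOn ℝ n (riccatiDeriv A b Q γ) (Ioi 0) := by
  have hK := contDiffOn_optGain hγ hQ hQ0 hctrl hP
  have hM := contDiffOn_optClosedLoop hγ hQ hQ0 hctrl hP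
  exact fun r hr => ContDiffWithinAt.steinSolve ((contDiff_transpose.comp_contDiffOn hM) r hr)
    (hM r hr) (contDiffOn_vecMulVec hK hK r hr)
    (stein_riccati_injective hγ hr hQ hQ0 hctrl hobs)

theorem hasDerivAt_riccatiLimit (hγ : 0 < γ) (hr : 0 < r) (hQ : Q.IsSymm)
    (hQ0 : ∀ x, 0 ≤ bform Q x x) (hctrl : Controllable A b) (hobs : ObservableCost A Q)
    (hP : ContinuousOn (riccatiLimit A b Q γ) (Ioi 0)) :
    HasDerivAt (riccatiLimit A b Q γ) (riccatiDeriv A b Q γ r) r := by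
  have hP' : ContDiffOn ℝ 0 (riccatiLimit A b Q γ) (Ioi 0) := contDiffOn_zero.2 hP
  have hr' : Ioi (0 : ℝ) ∈ 𝓝 r := Ioi_mem_nhds hr
  have hK : ContinuousAt (optGain A b Q γ) r :=
    (contDiffOn_optGain hγ hQ hQ0 hctrl hP').continuousOn.continuousAt hr'
  have hM : ContinuousAt (fun s => closedLoop A b (optGain A b Q γ s)) r :=
    (contDiffOn_optClosedLoop hγ hQ hQ0 hctrl hP').continuousOn.continuousAt hr'
  have hV : ContinuousAt
      (fun s => Matrix.vecMulVec (optGain A b Q γ r) (optGain A b Q γ s)) r :=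
    tendsto_vecMulVec tendsto_const_nhds hK
  have hmix : ∀ᶠ s in 𝓝 r, (riccatiLimit A b Q γ s - riccatiLimit A b Q γ r) -
      γ • ((closedLoop A b (optGain A b Q γ r))ᵀ *
        (riccatiLimit A b Q γ s - riccatiLimit A b Q γ r) *
          closedLoop A b (optGain A b Q γ s)) =
      (s - r) • Matrix.vecMulVec (optGain A b Q γ r) (optGain A b Q γ s) := by
    filter_upwards [hr'] with s hs0
    exact riccati_sub_riccati
      (weight_pos hγ.le hs0 (riccatiLimit_nonneg hγ.le hs0 hQ hQ0 hctrl)).ne'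
      (weight_pos hγ.le hr (riccatiLimit_nonneg hγ.le hr hQ hQ0 hctrl)).ne'
      (isSymm_riccatiLimit hγ.le hr hQ hQ0 hctrl)
      (riccatiStep_riccatiLimit hγ.le hs0 hQ hQ0 hctrl)
      (riccatiStep_riccatiLimit hγ.le hr hQ hQ0 hctrl)
  exact hasDerivAt_of_stein (P := riccatiLimit A b Q γ)
    (R := fun s => closedLoop A b (optGain A b Q γ s))
    (V := fun s => Matrix.vecMulVec (optGain A b Q γ r) (optGain A b Q γ s))
    (L := (closedLoop A b (optGain A b Q γ r))ᵀ) hM hV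
    (stein_riccati_injective hγ hr hQ hQ0 hctrl hobs) hmix

/-- The derivative is a smooth expression in `P` and the weight, so each order of regularity of `P`
yields the next; two rounds starting from continuity are enough. -/
theorem contDiffOn_riccatiLimit (hγ : 0 < γ) (hQ : Q.IsSymm)
    (hQ0 : ∀ x, 0 ≤ bform Q x x) (hctrl : Controllable A b) (hobs : ObservableCost A Q)
    (hP : ContinuousOn (riccatiLimit A b Q γ) (Ioi 0)) :
    ContDiffOn ℝ 2 (riccatiLimit A b Q γ) (Ioi 0) := by
  have hd : ∀ r ∈ Ioi (0 : ℝ), HasDerivAt (riccatiLimit A b Q γ) (riccatiDeriv A b Q γ r) r :=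
    fun r hr => hasDerivAt_riccatiLimit hγ hr hQ hQ0 hctrl hobs hP
  have hstep : ∀ n : ℕ, ContDiffOn ℝ n (riccatiLimit A b Q γ) (Ioi 0) →
      ContDiffOn ℝ (n + 1) (riccatiLimit A b Q γ) (Ioi 0) := fun n hn => by
    rw [contDiffOn_succ_iff_deriv_of_isOpen isOpen_Ioi]
    refine ⟨fun r hr => (hd r hr).differentiableAt.differentiableWithinAt, by simp, ?_⟩
    exact (contDiffOn_riccatiDeriv hγ hQ hQ0 hctrl hobs hn).congr fun r hr => (hd r hr).deriv
  have h1 := hstep 0 (contDiffOn_zero.2 hP)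
  have h2 := hstep 1 (by simpa using h1)
  exact h2.of_le (by norm_num)

end Smooth

theorem isLinearMap_value {F : Measure (Fin d → ℝ)} (hF2 : ∀ i, MemLp (fun n : Fin d → ℝ => n i) 2 F) (c : ℝ)
    (x : Fin d → ℝ) :
    IsLinearMap ℝ fun P : Matrix (Fin d) (Fin d) ℝ => bform P x x + c * noiseCost F P := by
  constructor
  · intro P P'
    have : noiseCost F (P + P') = noiseCost F P + noiseCost F P' := by
      simp only [noiseCost, bform_add]
      exact integral_add (integrable_bform_self hF2 P) (integrable_bform_self hF2 P')
    rw [bform_add, this]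
    ring
  · intro a P
    have : noiseCost F (a • P) = a * noiseCost F P := by
      simp only [noiseCost, bform_smul]
      exact integral_const_mul _ _
    rw [bform_smul, this, smul_eq_mul]
    ring

/-- A nonnegative form with zero mean vanishes almost surely, so each row of `P` is almost surely
orthogonal to the disturbance. That row then has zero variance in the covariance form, which is
definite. -/
theorem eq_zero_of_noiseCost_eq_zero {F : Measure (Fin d → ℝ)}
    {P : Matrix (Fin d) (Fin d) ℝ}
    (hF2 : ∀ i, MemLp (fun n : Fin d → ℝ => n i) 2 F)
    (hcov : (Matrix.of fun i j : Fin d => ∫ n, n i * n j ∂F).PosDef) (hP : P.IsSymm)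
    (hP0 : ∀ x, 0 ≤ bform P x x) (h : noiseCost F P = 0) : P = 0 := by
  have hpsd : P.PosSemidef := Matrix.PosSemidef.of_dotProduct_mulVec_nonneg
    (by rw [Matrix.IsHermitian, Matrix.conjTranspose_eq_transpose_of_trivial]; exact hP) fun x => by simpa [bform] using hP0 x
  have h1 : ∀ᵐ n ∂F, P *ᵥ n = 0 := by
    have := (integral_eq_zero_iff_of_nonneg (fun n => hP0 n) (integrable_bform_self hF2 P)).1 h
    filter_upwards [this] with n hn
    refine (hpsd.dotProduct_mulVec_zero_iff n).1 ?_
    simpa [bform] using hn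
  have h2 : ∀ i, P i = 0 := fun i => by
    by_contra hi
    have hpos := hcov.dotProduct_mulVec_pos hi
    have h3 : noiseCost F (Matrix.vecMulVec (P i) (P i)) = 0 := by
      rw [noiseCost]
      refine integral_eq_zero_of_ae ?_
      filter_upwards [h1] with n hn
      have : P i ⬝ᵥ n = 0 := congrFun hn i
      rw [bform_vecMulVec, this]
      simp
    rw [noiseCost_eq_sum hF2] at h3
    refine hpos.ne' (Eq.trans ?_ h3)
    simp only [star_trivial, dotProduct, Matrix.mulVec, Finset.mul_sum, Matrix.of_apply,
      Matrix.vecMulVec_apply]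
    exact Finset.sum_congr rfl fun j _ => Finset.sum_congr rfl fun k _ => by ring
  ext i j
  exact congrFun (h2 i) j

/-! ### Continuity of the Riccati solution and the derivative of the optimal cost. -/

section Derivative

variable {A : Matrix (Fin d) (Fin d) ℝ} {b : Fin d → ℝ} {F : Measure (Fin d → ℝ)}
  [IsProbabilityMeasure F] {Q : Matrix (Fin d) (Fin d) ℝ} {γ r : ℝ}

theorem optCost_ne_top (hF2 : ∀ i, MemLp (fun n : Fin d → ℝ => n i) 2 F)
    (hF0 : ∀ i, ∫ n, n i ∂F = 0) (hγ : 0 ≤ γ) (hγ1 : γ < 1) (hr : 0 < r) (hQ : Q.IsSymm)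
    (hQ0 : ∀ x, 0 ≤ bform Q x x) (hctrl : Controllable A b) (x : Fin d → ℝ) :
    optCost A b F Q γ r x ≠ ∞ := by
  rw [optCost_eq hF2 hF0 hγ hγ1 hr hQ hQ0 hctrl]
  exact ENNReal.ofReal_ne_top

theorem monotoneOn_J (hfin : ∀ r : ℝ, 0 < r → ∀ x : Fin d → ℝ, optCost A b F Q γ r x ≠ ∞)
    (hγ : 0 ≤ γ) (x : Fin d → ℝ) : MonotoneOn (fun r => J A b F Q γ r x) (Ioi 0) :=
  fun _ _ s hs hrs => ENNReal.toReal_mono (hfin s hs x) (optCost_mono hγ hrs x)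

theorem memLp_coord_dirac (i : Fin d) :
    MemLp (fun n : Fin d → ℝ => n i) 2 (Measure.dirac (0 : Fin d → ℝ)) := by
  refine (MemLp.zero (p := 2) (ε := ℝ)).ae_eq ?_
  have h : (fun n : Fin d → ℝ => n i) =ᵐ[Measure.dirac 0] Function.const _ 0 :=
    ae_eq_dirac' (measurable_pi_apply i)
  exact h.symm

/-- The noiseless system isolates the quadratic part, which transfers the concavity and monotonicity
of optimal costs to the Riccati solution. -/
theorem J_dirac (hγ : 0 ≤ γ) (hγ1 : γ < 1) (hr : 0 < r) (hQ : Q.IsSymm)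
    (hQ0 : ∀ x, 0 ≤ bform Q x x) (hctrl : Controllable A b) (x : Fin d → ℝ) :
    J A b (Measure.dirac 0) Q γ r x = bform (riccatiLimit A b Q γ r) x x := by
  rw [J_eq memLp_coord_dirac (fun i => by simp) hγ hγ1 hr hQ hQ0 hctrl, noiseCost]
  simp

theorem concaveOn_bform_riccatiLimit (hγ : 0 ≤ γ) (hγ1 : γ < 1) (hQ : Q.IsSymm)
    (hQ0 : ∀ x, 0 ≤ bform Q x x) (hctrl : Controllable A b) (x : Fin d → ℝ) :
    ConcaveOn ℝ (Ioi 0) (fun r => bform (riccatiLimit A b Q γ r) x x) :=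
  (concaveOn_J (F := Measure.dirac 0) (fun x r hr => optCost_ne_top memLp_coord_dirac
    (fun i => by simp) hγ hγ1 hr hQ hQ0 hctrl x) hγ hQ0 x).congr
    fun r hr => J_dirac hγ hγ1 hr hQ hQ0 hctrl x

/-- Concave functions on an open interval are continuous; polarization passes to the entries. This
is the starting point of the regularity bootstrap. -/
theorem continuousOn_riccatiLimit (hγ : 0 ≤ γ) (hγ1 : γ < 1) (hQ : Q.IsSymm)
    (hQ0 : ∀ x, 0 ≤ bform Q x x) (hctrl : Controllable A b) :
    ContinuousOn (riccatiLimit A b Q γ) (Ioi 0) := by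
  have hx : ∀ x, ContinuousOn (fun r => bform (riccatiLimit A b Q γ r) x x) (Ioi 0) := fun x => by
    simpa using (concaveOn_bform_riccatiLimit hγ hγ1 hQ hQ0 hctrl x).continuousOn_interior
  refine continuousOn_pi.2 fun i => continuousOn_pi.2 fun j => ?_
  refine (((hx (Pi.single i 1 + Pi.single j 1)).sub (hx (Pi.single i 1))).sub
    (hx (Pi.single j 1))).div_const 2 |>.congr fun r hr => ?_
  exact (bform_single _ i j).symm.trans
    (bform_polarization (isSymm_riccatiLimit hγ hr hQ hQ0 hctrl) _ _)

section Norm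

open scoped Matrix.Norms.Operator

theorem contDiffOn_J (hF2 : ∀ i, MemLp (fun n : Fin d → ℝ => n i) 2 F)
    (hF0 : ∀ i, ∫ n, n i ∂F = 0) (hγ : 0 < γ) (hγ1 : γ < 1) (hQ : Q.IsSymm)
    (hQ0 : ∀ x, 0 ≤ bform Q x x) (hctrl : Controllable A b) (hobs : ObservableCost A Q)
    (x : Fin d → ℝ) : ContDiffOn ℝ 2 (fun r => J A b F Q γ r x) (Ioi 0) := by
  have hP := contDiffOn_riccatiLimit hγ hQ hQ0 hctrl hobs
    (continuousOn_riccatiLimit hγ.le hγ1 hQ hQ0 hctrl)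
  exact ((contDiff_of_linear (isLinearMap_value hF2 (γ / (1 - γ)) x)).comp_contDiffOn hP).congr
    fun r hr => J_eq hF2 hF0 hγ.le hγ1 hr hQ hQ0 hctrl x

theorem hasDerivAt_J (hF2 : ∀ i, MemLp (fun n : Fin d → ℝ => n i) 2 F)
    (hF0 : ∀ i, ∫ n, n i ∂F = 0) (hγ : 0 < γ) (hγ1 : γ < 1) (hr : 0 < r) (hQ : Q.IsSymm)
    (hQ0 : ∀ x, 0 ≤ bform Q x x) (hctrl : Controllable A b) (hobs : ObservableCost A Q)
    (x : Fin d → ℝ) :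
    HasDerivAt (fun r => J A b F Q γ r x) (bform (riccatiDeriv A b Q γ r) x x +
      γ / (1 - γ) * noiseCost F (riccatiDeriv A b Q γ r)) r := by
  have hP := hasDerivAt_riccatiLimit hγ hr hQ hQ0 hctrl hobs
    (continuousOn_riccatiLimit hγ.le hγ1 hQ hQ0 hctrl)
  have h := (LinearMap.toContinuousLinearMap
    (isLinearMap_value hF2 (γ / (1 - γ)) x).mk').hasFDerivAt.comp_hasDerivAt r hP
  refine HasDerivAt.congr_of_eventuallyEq h ?_
  filter_upwards [Ioi_mem_nhds hr] with s hs
  exact J_eq hF2 hF0 hγ.le hγ1 hs hQ hQ0 hctrl x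

theorem isSymm_riccatiDeriv (hγ : 0 < γ) (hγ1 : γ < 1) (hr : 0 < r) (hQ : Q.IsSymm)
    (hQ0 : ∀ x, 0 ≤ bform Q x x) (hctrl : Controllable A b) (hobs : ObservableCost A Q) :
    (riccatiDeriv A b Q γ r).IsSymm := by
  have hP := hasDerivAt_riccatiLimit hγ hr hQ hQ0 hctrl hobs
    (continuousOn_riccatiLimit hγ.le hγ1 hQ hQ0 hctrl)
  have h := (LinearMap.toContinuousLinearMap
    (Matrix.transposeLinearEquiv (Fin d) (Fin d) ℝ ℝ).toLinearMap).hasFDerivAt.comp_hasDerivAt r hP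
  refine HasDerivAt.unique (HasDerivAt.congr_of_eventuallyEq h ?_) hP
  filter_upwards [Ioi_mem_nhds hr] with s hs
  exact (isSymm_riccatiLimit hγ.le hs hQ hQ0 hctrl).eq.symm

end Norm

theorem nonneg_of_hasDerivAt_of_monotoneOn {f : ℝ → ℝ} {f' : ℝ} (hf : HasDerivAt f f' r)
    (hr : 0 < r) (hm : MonotoneOn f (Ioi 0)) : 0 ≤ f' := by
  have h := hm.derivWithin_nonneg (x := r)
  rwa [derivWithin_of_isOpen isOpen_Ioi hr, hf.deriv] at h

theorem riccatiDeriv_nonneg (hγ : 0 < γ) (hγ1 : γ < 1) (hr : 0 < r) (hQ : Q.IsSymm)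
    (hQ0 : ∀ x, 0 ≤ bform Q x x) (hctrl : Controllable A b) (hobs : ObservableCost A Q)
    (x : Fin d → ℝ) : 0 ≤ bform (riccatiDeriv A b Q γ r) x x := by
  have h := hasDerivAt_J (F := Measure.dirac 0) memLp_coord_dirac (fun i => by simp) hγ hγ1 hr
    hQ hQ0 hctrl hobs x
  have h0 : noiseCost (Measure.dirac 0) (riccatiDeriv A b Q γ r) = 0 := by simp [noiseCost]
  rw [h0, mul_zero, add_zero] at h
  exact nonneg_of_hasDerivAt_of_monotoneOn h hr (monotoneOn_J (fun r hr x =>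
    optCost_ne_top memLp_coord_dirac (fun i => by simp) hγ.le hγ1 hr hQ hQ0 hctrl x) hγ.le x)

theorem optGain_eq_zero_of_riccatiDeriv_eq_zero (hγ : 0 < γ) (hr : 0 < r)
    (hQ : Q.IsSymm) (hQ0 : ∀ x, 0 ≤ bform Q x x) (hctrl : Controllable A b)
    (hobs : ObservableCost A Q) (h : riccatiDeriv A b Q γ r = 0) : optGain A b Q γ r = 0 := by
  have hs := riccatiDeriv_spec hγ hr hQ hQ0 hctrl hobs
  rw [h] at hs
  simp only [Matrix.mul_zero, Matrix.zero_mul, smul_zero, sub_zero] at hs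
  ext i
  have := congrFun (congrFun hs i) i
  simpa [Matrix.vecMulVec_apply] using this.symm

/-- With zero gain the optimality condition reads `bᵀ P A = 0`, so invertibility of `A` gives `bᵀ P
b = 0`. The uncontrolled orbit of `b` then has zero cost at all times, hence is unobserved. -/
theorem eq_zero_of_optGain_eq_zero (hγ : 0 < γ) (hr : 0 < r) (hQ : Q.IsSymm)
    (hQ0 : ∀ x, 0 ≤ bform Q x x) (hctrl : Controllable A b) (hobs : ObservableCost A Q)
    (hA : A.det ≠ 0) (h : optGain A b Q γ r = 0) : b = 0 := by
  obtain ⟨C, hC, hobs⟩ := hobs.exists_factor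
  have hP0 := riccatiLimit_nonneg hγ.le hr hQ hQ0 hctrl
  have hen := bform_riccatiLimit_self hγ.le hr hQ hQ0 hctrl
  have hopt := gain_optimality (A := A) (b := b) (weight_pos hγ.le hr hP0).ne'
  rw [optGain] at h
  simp only [h, closedLoop_mulVec, zero_dotProduct, zero_smul, add_zero, mul_zero, zero_add,
    ne_eq, OfNat.ofNat_ne_zero, not_false_eq_true, zero_pow, mul_eq_zero, hγ.ne', false_or]
    at hopt hen
  have hb : bform (riccatiLimit A b Q γ r) b b = 0 := by
    have hu : IsUnit A.det := isUnit_iff_ne_zero.2 hA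
    have := hopt (A⁻¹ *ᵥ b)
    rwa [Matrix.mulVec_mulVec, Matrix.mul_nonsing_inv _ hu, Matrix.one_mulVec] at this
  have hsplit : ∀ y, bform (riccatiLimit A b Q γ r) y y = 0 → bform Q y y = 0 ∧
      bform (riccatiLimit A b Q γ r) (A *ᵥ y) (A *ᵥ y) = 0 := fun y hy => by
    rw [hen] at hy
    have h2 := mul_nonneg hγ.le (hP0 (A *ᵥ y))
    have h3 := hQ0 y
    refine ⟨by linarith, (mul_eq_zero.1 (by linarith :
      γ * bform (riccatiLimit A b Q γ r) (A *ᵥ y) (A *ᵥ y) = 0)).resolve_left hγ.ne'⟩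
  have hk : ∀ k : ℕ, bform (riccatiLimit A b Q γ r) (A ^ k *ᵥ b) (A ^ k *ᵥ b) = 0 := fun k => by
    induction k with
    | zero => simpa using hb
    | succ k ih =>
      rw [pow_succ', ← Matrix.mulVec_mulVec]
      exact (hsplit _ ih).2
  refine hobs b fun k => ?_
  have := (hsplit _ (hk k)).1
  rw [hC, dotProduct_self_eq_zero] at this
  rw [← Matrix.mulVec_mulVec, this]

end Derivative

/-! ### Signs of the derivatives and strict positivity. -/

section Positivity

variable {A : Matrix (Fin d) (Fin d) ℝ} {b : Fin d → ℝ} {F : Measure (Fin d → ℝ)}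
  [IsProbabilityMeasure F] {Q : Matrix (Fin d) (Fin d) ℝ} {γ r : ℝ}

theorem deriv_J_nonneg (hF2 : ∀ i, MemLp (fun n : Fin d → ℝ => n i) 2 F)
    (hF0 : ∀ i, ∫ n, n i ∂F = 0) (hγ : 0 < γ) (hγ1 : γ < 1) (hr : 0 < r) (hQ : Q.IsSymm)
    (hQ0 : ∀ x, 0 ≤ bform Q x x) (hctrl : Controllable A b) (hobs : ObservableCost A Q)
    (x : Fin d → ℝ) : 0 ≤ deriv (fun s => J A b F Q γ s x) r := by
  have hd := hasDerivAt_J hF2 hF0 hγ hγ1 hr hQ hQ0 hctrl hobs x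
  rw [hd.deriv]
  exact nonneg_of_hasDerivAt_of_monotoneOn hd hr (monotoneOn_J (fun s hs y =>
    optCost_ne_top hF2 hF0 hγ.le hγ1 hs hQ hQ0 hctrl y) hγ.le x)

theorem deriv_deriv_J_nonpos (hF2 : ∀ i, MemLp (fun n : Fin d → ℝ => n i) 2 F)
    (hF0 : ∀ i, ∫ n, n i ∂F = 0) (hγ : 0 < γ) (hγ1 : γ < 1) (hr : 0 < r) (hQ : Q.IsSymm)
    (hQ0 : ∀ x, 0 ≤ bform Q x x) (hctrl : Controllable A b) (hobs : ObservableCost A Q)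
    (x : Fin d → ℝ) : deriv (deriv fun s => J A b F Q γ s x) r ≤ 0 := by
  have hc := concaveOn_J (F := F) (fun y s hs =>
    optCost_ne_top hF2 hF0 hγ.le hγ1 hs hQ hQ0 hctrl y) hγ.le hQ0 x
  have ha := hc.antitoneOn_deriv fun s hs =>
    (hasDerivAt_J hF2 hF0 hγ hγ1 hs hQ hQ0 hctrl hobs x).differentiableAt
  have h := ha.derivWithin_nonpos (x := r)
  rwa [derivWithin_of_isOpen isOpen_Ioi hr] at h

theorem deriv_J_eq_zero_iff (hF2 : ∀ i, MemLp (fun n : Fin d → ℝ => n i) 2 F)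
    (hF0 : ∀ i, ∫ n, n i ∂F = 0) (hγ : 0 < γ) (hγ1 : γ < 1) (hr : 0 < r) (hQ : Q.IsSymm)
    (hQ0 : ∀ x, 0 ≤ bform Q x x) (hctrl : Controllable A b) (hobs : ObservableCost A Q)
    (x : Fin d → ℝ) : deriv (fun s => J A b F Q γ s x) r = 0 ↔
      cost A b F Q γ r (zeroPolicy d) x = optCost A b F Q γ r x := by
  have hfin : ∀ s : ℝ, 0 < s → optCost A b F Q γ s x ≠ ∞ := fun s hs =>
    optCost_ne_top hF2 hF0 hγ.le hγ1 hs hQ hQ0 hctrl x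
  constructor
  · intro h0
    refine le_antisymm ?_ (iInf_le _ _)
    refine cost_zeroPolicy_le_of_forall_optCost_le hF2 hF0 hγ.le hr hQ hQ0 x ?_
    filter_upwards [eventually_gt_atTop r] with s hs
    have hs0 : 0 < s := hr.trans hs
    have hc := concaveOn_J (F := F) (fun y s hs =>
      optCost_ne_top hF2 hF0 hγ.le hγ1 hs hQ hQ0 hctrl y) hγ.le hQ0 x
    have hd := (hasDerivAt_J hF2 hF0 hγ hγ1 hr hQ hQ0 hctrl hobs x).differentiableAt.hasDerivAt
    rw [h0] at hd
    -- A concave function with zero slope at `r` cannot exceed its value at `r` further to the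
    -- right.
    have hsl := hc.slope_le_of_hasDerivAt hr hs0 hs hd
    rw [slope_def_field, div_nonpos_iff] at hsl
    have hJ : J A b F Q γ s x ≤ J A b F Q γ r x := by
      rcases hsl with h | h
      · linarith [h.2]
      · linarith [h.1]
    exact (ENNReal.toReal_le_toReal (hfin s hs0) (hfin r hr)).1 hJ
  · intro h
    -- Zero control costs the same for every weight, so its cost bounds `J` from above everywhere
    -- and equals `J` at `r`.
    refine IsLocalMax.deriv_eq_zero ?_
    filter_upwards [Ioi_mem_nhds hr] with s hs
    refine ENNReal.toReal_mono (hfin r hr) ?_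
    rw [← h, cost_zeroPolicy_congr s x hγ.le]
    exact iInf_le _ _

theorem deriv_J_pos_of_nondegenerate (hF2 : ∀ i, MemLp (fun n : Fin d → ℝ => n i) 2 F)
    (hF0 : ∀ i, ∫ n, n i ∂F = 0) (hγ : 0 < γ) (hγ1 : γ < 1) (hr : 0 < r) (hQ : Q.IsSymm)
    (hQ0 : ∀ x, 0 ≤ bform Q x x) (hctrl : Controllable A b) (hobs : ObservableCost A Q)
    (hd : 0 < d) (hA : A.det ≠ 0)
    (hcov : (Matrix.of fun i j : Fin d => ∫ n, n i * n j ∂F).PosDef) (x : Fin d → ℝ) :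
    0 < deriv (fun s => J A b F Q γ s x) r := by
  refine (deriv_J_nonneg hF2 hF0 hγ hγ1 hr hQ hQ0 hctrl hobs x).lt_of_ne' fun h => ?_
  rw [(hasDerivAt_J hF2 hF0 hγ hγ1 hr hQ hQ0 hctrl hobs x).deriv] at h
  have hR := riccatiDeriv_nonneg hγ hγ1 hr hQ hQ0 hctrl hobs
  have hγ' : 0 < γ / (1 - γ) := div_pos hγ (by linarith)
  have hN := noiseCost_nonneg (F := F) hR
  have hN0 : noiseCost F (riccatiDeriv A b Q γ r) = 0 := by
    have := hR x
    have := mul_nonneg hγ'.le hN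
    exact (mul_eq_zero.1 (by linarith :
      γ / (1 - γ) * noiseCost F (riccatiDeriv A b Q γ r) = 0)).resolve_left hγ'.ne'
  have hP := eq_zero_of_noiseCost_eq_zero hF2 hcov
    (isSymm_riccatiDeriv hγ hγ1 hr hQ hQ0 hctrl hobs) hR hN0
  have hb := eq_zero_of_optGain_eq_zero hγ hr hQ hQ0 hctrl hobs hA
    (optGain_eq_zero_of_riccatiDeriv_eq_zero hγ hr hQ hQ0 hctrl hobs hP)
  -- With `b = 0` the controllable subspace is trivial, which is impossible in positive dimension.
  have hspan : (⊤ : Submodule ℝ (Fin d → ℝ)) = ⊥ := by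
    rw [← hctrl, Submodule.span_eq_bot]
    rintro _ ⟨k, rfl⟩
    simp [hb]
  have hmem : (Pi.single ⟨0, hd⟩ 1 : Fin d → ℝ) ∈ (⊤ : Submodule ℝ (Fin d → ℝ)) := trivial
  rw [hspan, Submodule.mem_bot] at hmem
  have := congrFun hmem ⟨0, hd⟩
  simp at this

end Positivity

end LQR

end

theorem theorem1 {d : ℕ} (A : Matrix (Fin d) (Fin d) ℝ) (b : Fin d → ℝ)
    (F : Measure (Fin d → ℝ)) [IsProbabilityMeasure F] (Q : Matrix (Fin d) (Fin d) ℝ) (γ : ℝ)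
    (hF2 : ∀ i, MemLp (fun n : Fin d → ℝ => n i) 2 F)
    (hF0 : ∀ i, ∫ n, n i ∂F = 0)
    (hQ : Q.PosSemidef) (hγ0 : 0 < γ) (hγ1 : γ < 1)
    (hctrl : LQR.Controllable A b) (hobs : LQR.ObservableCost A Q) :
    (∀ x : Fin d → ℝ,
      -- the optimal cost is finite
      (∀ r : ℝ, 0 < r → LQR.optCost A b F Q γ r x ≠ ∞) ∧
      -- it is concave, nondecreasing and twice continuously differentiable in `r`
      ConcaveOn ℝ (Ioi 0) (fun r => LQR.J A b F Q γ r x) ∧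
      MonotoneOn (fun r => LQR.J A b F Q γ r x) (Ioi 0) ∧
      ContDiffOn ℝ 2 (fun r => LQR.J A b F Q γ r x) (Ioi 0) ∧
      (∀ r : ℝ, 0 < r → deriv (deriv fun s => LQR.J A b F Q γ s x) r ≤ 0) ∧
      (∀ r : ℝ, 0 < r → 0 ≤ deriv (fun s => LQR.J A b F Q γ s x) r) ∧
      -- the first derivative is positive unless exerting no control at all is optimal
      (∀ r : ℝ, 0 < r →
        (0 < deriv (fun s => LQR.J A b F Q γ s x) r ↔
          LQR.cost A b F Q γ r (LQR.zeroPolicy d) x ≠ LQR.optCost A b F Q γ r x))) ∧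
    -- for nondegenerate dynamics and disturbances it is positive everywhere
    (0 < d → A.det ≠ 0 →
      (Matrix.of fun i j : Fin d => ∫ n, n i * n j ∂F).PosDef →
      ∀ (x : Fin d → ℝ) (r : ℝ), 0 < r → 0 < deriv (fun s => LQR.J A b F Q γ s x) r) := by
  have hQs : Q.IsSymm := by
    have := hQ.isHermitian
    rwa [Matrix.IsHermitian, Matrix.conjTranspose_eq_transpose_of_trivial] at this
  have hQ0 : ∀ x, 0 ≤ LQR.bform Q x x := fun x => by
    simpa [LQR.bform] using hQ.dotProduct_mulVec_nonneg x
  have hfin : ∀ (x : Fin d → ℝ) (r : ℝ), 0 < r → LQR.optCost A b F Q γ r x ≠ ∞ := fun x r hr =>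
    LQR.optCost_ne_top hF2 hF0 hγ0.le hγ1 hr hQs hQ0 hctrl x
  refine ⟨fun x => ⟨hfin x, LQR.concaveOn_J hfin hγ0.le hQ0 x,
    LQR.monotoneOn_J (fun r hr y => hfin y r hr) hγ0.le x,
    LQR.contDiffOn_J hF2 hF0 hγ0 hγ1 hQs hQ0 hctrl hobs x,
    fun r hr => LQR.deriv_deriv_J_nonpos hF2 hF0 hγ0 hγ1 hr hQs hQ0 hctrl hobs x,
    fun r hr => LQR.deriv_J_nonneg hF2 hF0 hγ0 hγ1 hr hQs hQ0 hctrl hobs x,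
    fun r hr => ?_⟩, fun hd hA hcov x r hr =>
    LQR.deriv_J_pos_of_nondegenerate hF2 hF0 hγ0 hγ1 hr hQs hQ0 hctrl hobs hd hA hcov x⟩
  rw [ne_eq, ← LQR.deriv_J_eq_zero_iff hF2 hF0 hγ0 hγ1 hr hQs hQ0 hctrl hobs x]
  exact (LQR.deriv_J_nonneg hF2 hF0 hγ0 hγ1 hr hQs hQ0 hctrl hobs x).lt_iff_ne'
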